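/- Let $\kappa>0$ and $D_\kappa=\pi/\sqrt\kappa$. Let $M^2_\kappa$ be the unit sphere $\mathbb S^2\subset\mathbb R^3$ with the spherical metric multiplied by $1/\sqrt\kappa$. A metric space is a CAT$(\kappa)$ space if any two points at distance less than $D_\kappa$ are joined by a geodesic path and, for every geodesic triangle of perimeter less than $2D_\kappa$, the distance of any two of its points is at most the distance of the corresponding points of each comparison triangle in $M^2_\kappa$. We write $z=(1-t)x+ty$ ($t\in[0,1]$) if $d(z,x)=t\,d(x,y)$ and $d(z,y)=(1-t)\,d(x,y)$. A set is convex if it contains every geodesic segment joining two of its points. Let $X$ be a complete CAT$(\kappa)$ space, $C\subseteq X$ a bounded closed convex subset, $T:C\to C$ a nonexpansive mapping, and $M<D_\kappa/2$ an upper bound on the diameter of $C$. Put $\lambda_n=\frac1{n+1}$ for $n\ge1$, let $u\in C$, and let $(x_n)$ be the Halpern iteration $$x_0=u,\qquad x_{n+1}=\lambda_{n+1}u+(1-\lambda_{n+1})Tx_n .$$ Then for all $\varepsilon\in(0,2)$ and all $g:\mathbb N\to\mathbb N$ (with $0\in\mathbb N$), $$\exists N\le\Sigma(\varepsilon,g,\kappa,M)\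 \ \forall m,n\in[N,N+g(N)]\quad d(x_n,x_m)\le\varepsilon ,$$ where, with $F(i)=i+f^*(i)$ and $F^{B}$ the $B$-th iterate of $F$, $$\Sigma(\varepsilon,g,\kappa,M)=A\left(F^{B}(0)+\left\lceil\tfrac1{\varepsilon_0}\right\rceil\right),$$ and $$\varepsilon_0=\frac{\cos(M\sqrt\kappa)}{36}\sin^2\frac{\varepsilon\sqrt\kappa}4,\qquad B=\left\lceil\frac{M\sqrt\kappa\,\tan(M\sqrt\kappa)}{1-\cos\varepsilon_0}\right\rceil,$$ $$A(n)=\exp\left(\left(\left\lceil\tfrac1{\cos(M\sqrt\kappa)}\right\rceil\big(\Gamma(n)-1+\max\{S,1\}\big)+1\right)\ln4\right)+1,$$ $$\Gamma(n)=\chi^*_n\left(\tfrac13\sin^2\tfrac{\varepsilon\sqrt\kappa}4\right),\qquad S=\left\lceil\ln\left(\frac{3\sin^2\frac{M\sqrt\kappa}4}{\sin^2\frac{\varepsilon\sqrt\kappa}4}\right)\right\rceil,$$ $$\chi_i(\delta)=\exp\left(\left(\left\lceil\tfrac1{\cos(M\sqrt\kappa)}\right\rceil\left(\left\lceil\tfrac1{L_i}\right\rceil+\max\left\{\left\lceil\ln\tfrac1{L_i}\right\rceil,1\right\}\right)+1\right)\ln4\right),\qquad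 L_i=\frac{\cos(M\sqrt\kappa)\,\delta}{4M\sqrt\kappa\,(i+1)},$$ $$\chi^*_i(\delta)=\chi_i\left(\tfrac\delta2\cos(M\sqrt\kappa)\right),$$ $$\Theta_i(\delta)=\exp\left(\left(\left\lceil\tfrac1{\cos(M\sqrt\kappa)}\right\rceil\left(\chi^*_i\left(\tfrac\delta3\right)-1+\max\{T_\delta,1\}\right)+1\right)\ln4\right)+1,\qquad T_\delta=\left\lceil\ln\left(\tfrac3\delta\sin^2\tfrac{M\sqrt\kappa}2\right)\right\rceil,$$ $$\Delta^*_i(\delta,g)=\frac{\delta}{3\Theta_i(\delta)-3\chi^*_i\left(\frac\delta3\right)+3g(\Theta_i(\delta))},$$ $$f(i)=\max\left\{\left\lceil\frac{M\sqrt\kappa}{\Delta^*_i\left(\sin^2\frac{\varepsilon\sqrt\kappa}4,g\right)}\right\rceil,i\right\}-i,\qquad f^*(i)=f\left(i+\left\lceil\tfrac1{\varepsilon_0}\right\rceil\right)+\left\lceil\tfrac1{\varepsilon_0}\right\rceil .$$ (If $M=0$ or $\sin\frac{\varepsilon\sqrt\kappa}4=0$, quotients with denominator $0$ and $\ln 0$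 are read as $0$; in these cases $d(x_n,x_m)\le M<\varepsilon$ for all $m,n$.) -/

import Mathlib

noncomputable section

namespace HalpernCAT

/-! ### Geodesics and convexity -/

/-- `c` restricted to `[0, d(x,y)]` is a geodesic path from `x` to `y`. (The length of the parameter
interval of a geodesic path from `x` to `y` is necessarily `d(x,y)`.) -/
structure IsGeodesicPath {X : Type*} [MetricSpace X] (x y : X) (c : ℝ → X) : Prop where
  source : c 0 = x
  target : c (dist x y) = y
  isometric : ∀ s ∈ Set.Icc 0 (dist x y), ∀ t ∈ Set.Icc 0 (dist x y), dist (c s) (c t) = |s - t|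

/-- A set is convex if it contains every geodesic segment joining two of its points. -/
def IsGeodesicallyConvex {X : Type*} [MetricSpace X] (C : Set X) : Prop :=
  ∀ x ∈ C, ∀ y ∈ C, ∀ c : ℝ → X, IsGeodesicPath x y c → c '' Set.Icc 0 (dist x y) ⊆ C

/-- `z = (1 - t) x + t y`, that is, `d(z,x) = t d(x,y)` and `d(z,y) = (1 - t) d(x,y)`. -/
def IsConvexCombination {X : Type*} [MetricSpace X] (x y : X) (t : ℝ) (z : X) : Prop :=
  dist z x = t * dist x y ∧ dist z y = (1 - t) * dist x y

/-! ### The model surface and CAT(κ) spaces, κ > 0 -/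

/-- The points of the model space `M²_κ`: the unit sphere of Euclidean 3-space. -/
abbrev ModelSpace : Type := Metric.sphere (0 : EuclideanSpace ℝ (Fin 3)) 1

/-- The metric of `M²_κ`: the spherical distance multiplied by `1/√κ`. -/
def modelDist (κ : ℝ) (p q : ModelSpace) : ℝ :=
  Real.arccos (inner ℝ (p : EuclideanSpace ℝ (Fin 3)) (q : EuclideanSpace ℝ (Fin 3))) / √κ

/-- The diameter `D_κ = π/√κ` of `M²_κ`. -/
def modelDiam (κ : ℝ) : ℝ := Real.pi / √κ

/-- A geodesic triangle: vertices `p 0, p 1, p 2`, and for each `k` a geodesic path `c k` from `p k`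
to `p (k + 1)` (indices modulo 3) whose image is the corresponding edge. -/
structure IsGeodesicTriangle {X : Type*} [MetricSpace X] (p : Fin 3 → X) (c : Fin 3 → ℝ → X) :
    Prop where
  edge : ∀ k, IsGeodesicPath (p k) (p (k + 1)) (c k)

/-- `q` gives the vertices of a `κ`-comparison triangle of a triangle with vertices `p`. -/
def IsComparisonTriangle {X : Type*} [MetricSpace X] (κ : ℝ) (p : Fin 3 → X)
    (q : Fin 3 → ModelSpace) : Prop :=
  ∀ i j, modelDist κ (q i) (q j) = dist (p i) (p j)

/-- `z` is the point of the comparison edge from `q k` to `q (k + 1)` that corresponds to the point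
at distance `s` from `p k` on the edge from `p k` to `p (k + 1)`. -/
def IsComparisonPoint {X : Type*} [MetricSpace X] (κ : ℝ) (p : Fin 3 → X) (q : Fin 3 → ModelSpace)
    (k : Fin 3) (s : ℝ) (z : ModelSpace) : Prop :=
  modelDist κ (q k) z = s ∧ modelDist κ z (q (k + 1)) = dist (p k) (p (k + 1)) - s

/-- The CAT(κ) inequality for the geodesic triangle given by `p` and `c`: two points of the triangle
are not farther apart than their comparison points, in every comparison triangle. -/
def SatisfiesCATInequality {X : Type*} [MetricSpace X] (κ : ℝ) (p : Fin 3 → X)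
    (c : Fin 3 → ℝ → X) : Prop :=
  ∀ q : Fin 3 → ModelSpace, IsComparisonTriangle κ p q →
    ∀ k l : Fin 3, ∀ s ∈ Set.Icc 0 (dist (p k) (p (k + 1))),
      ∀ t ∈ Set.Icc 0 (dist (p l) (p (l + 1))), ∀ z w : ModelSpace,
        IsComparisonPoint κ p q k s z → IsComparisonPoint κ p q l t w →
          dist (c k s) (c l t) ≤ modelDist κ z w

/-- CAT(κ) spaces (used for `κ > 0`). -/
structure IsCATSpace (κ : ℝ) (X : Type*) [MetricSpace X] : Prop where
  exists_geodesic : ∀ x y : X, dist x y < modelDiam κ → ∃ c : ℝ → X, IsGeodesicPath x y c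
  cat_inequality : ∀ (p : Fin 3 → X) (c : Fin 3 → ℝ → X), IsGeodesicTriangle p c →
    dist (p 0) (p 1) + dist (p 1) (p 2) + dist (p 2) (p 0) < 2 * modelDiam κ →
      SatisfiesCATInequality κ p c

/-- `x` is the Halpern iteration of `T` with parameters `lam 1, lam 2, …` starting at `u`:
`x 0 = u` and `x (n + 1) = lam (n + 1) u + (1 - lam (n + 1)) T (x n)`. -/
structure IsHalpernIteration {X : Type*} [MetricSpace X] {C : Set X} (T : C → C) (lam : ℕ → ℝ)
    (u : C) (x : ℕ → C) : Prop where
  zero : x 0 = u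
  succ : ∀ n, IsConvexCombination (u : X) (T (x n) : X) (1 - lam (n + 1)) (x (n + 1) : X)

/-! ### The constants and functionals of the bound

All integer quantities are natural numbers. A power `4 ^ k` is `exp (k ln 4)`, see
`four_pow_eq_exp`. The natural-number ceiling `⌈a⌉₊` equals `max ⌈a⌉ 0`; it is applied to nonnegative
numbers, or inside a maximum with `1`, where it may replace `⌈a⌉`. -/

theorem four_pow_eq_exp (k : ℕ) : ((4 ^ k : ℕ) : ℝ) = Real.exp (k * Real.log 4) := by
  rw [mul_comm, Real.exp_mul, Real.exp_log (by norm_num)]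
  norm_num

/-- `⌈1 / cos(M√κ)⌉` -/
def secCeil (κ M : ℝ) : ℕ := ⌈1 / Real.cos (M * √κ)⌉₊

/-- `sin²(ε√κ/4)` -/
def sinSq (ε κ : ℝ) : ℝ := Real.sin (ε * √κ / 4) ^ 2

/-- `ε₀ = (cos(M√κ) / 36) sin²(ε√κ/4)` -/
def eps0 (ε κ M : ℝ) : ℝ := Real.cos (M * √κ) / 36 * sinSq ε κ

/-- `B = ⌈M√κ tan(M√κ) / (1 - cos ε₀)⌉` -/
def boundB (ε κ M : ℝ) : ℕ :=
  ⌈M * √κ * Real.tan (M * √κ) / (1 - Real.cos (eps0 ε κ M))⌉₊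

/-- `L_i`, as a function of the argument `δ` of `χ_i`: `L_i = cos(M√κ) δ / (4 M√κ (i + 1))`. -/
def boundL (κ M : ℝ) (i : ℕ) (δ : ℝ) : ℝ :=
  Real.cos (M * √κ) * δ / (4 * M * √κ * (i + 1))

/-- `χ_i(δ) = exp((⌈1/cos(M√κ)⌉ (⌈1/L_i⌉ + max{⌈ln(1/L_i)⌉, 1}) + 1) ln 4)` -/
def chi (κ M : ℝ) (i : ℕ) (δ : ℝ) : ℕ :=
  4 ^ (secCeil κ M * (⌈1 / boundL κ M i δ⌉₊ + max ⌈Real.log (1 / boundL κ M i δ)⌉₊ 1) + 1)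

/-- `χ*_i(δ) = χ_i((δ/2) cos(M√κ))` -/
def chiStar (κ M : ℝ) (i : ℕ) (δ : ℝ) : ℕ := chi κ M i (δ / 2 * Real.cos (M * √κ))

/-- `χ*` is at least `1`, so that `χ* - 1` below is an honest difference. -/
theorem one_le_chiStar (κ M : ℝ) (i : ℕ) (δ : ℝ) : 1 ≤ chiStar κ M i δ :=
  Nat.one_le_pow _ _ (by norm_num)

/-- `max{T, 1}` with `T = ⌈ln((3/δ) sin²(M√κ/2))⌉`, as a function of the argument `δ` of `Θ_i`. -/
def maxT (κ M δ : ℝ) : ℕ := max ⌈Real.log (3 / δ * Real.sin (M * √κ / 2) ^ 2)⌉₊ 1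

/-- `max{S, 1}` with `S = ⌈ln(3 sin²(M√κ/4) / sin²(ε√κ/4))⌉`. -/
def maxS (ε κ M : ℝ) : ℕ := max ⌈Real.log (3 * Real.sin (M * √κ / 4) ^ 2 / sinSq ε κ)⌉₊ 1

/-- `Θ_i(δ) = exp((⌈1/cos(M√κ)⌉ (χ*_i(δ/3) - 1 + max{T, 1}) + 1) ln 4) + 1` -/
def Theta (κ M : ℝ) (i : ℕ) (δ : ℝ) : ℕ :=
  4 ^ (secCeil κ M * (chiStar κ M i (δ / 3) - 1 + maxT κ M δ) + 1) + 1

/-- `Δ*_i(δ, g) = δ / (3 Θ_i(δ) - 3 χ*_i(δ/3) + 3 g(Θ_i(δ)))` -/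
def DeltaStar (κ M : ℝ) (i : ℕ) (δ : ℝ) (g : ℕ → ℕ) : ℝ :=
  δ / (3 * (Theta κ M i δ : ℝ) - 3 * (chiStar κ M i (δ / 3) : ℝ) + 3 * (g (Theta κ M i δ) : ℝ))

/-- `f(i) = max{⌈M√κ / Δ*_i(sin²(ε√κ/4), g)⌉, i} - i` -/
def funF (ε : ℝ) (g : ℕ → ℕ) (κ M : ℝ) (i : ℕ) : ℕ :=
  max ⌈M * √κ / DeltaStar κ M i (sinSq ε κ) g⌉₊ i - i

/-- `f*(i) = f(i + ⌈1/ε₀⌉) + ⌈1/ε₀⌉` -/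
def fStar (ε : ℝ) (g : ℕ → ℕ) (κ M : ℝ) (i : ℕ) : ℕ :=
  funF ε g κ M (i + ⌈1 / eps0 ε κ M⌉₊) + ⌈1 / eps0 ε κ M⌉₊

/-- `i ↦ i + f*(i)` -/
def fStarTilde (ε : ℝ) (g : ℕ → ℕ) (κ M : ℝ) (i : ℕ) : ℕ := i + fStar ε g κ M i

/-- `Γ(n) = χ*_n((1/3) sin²(ε√κ/4))` -/
def Gam (ε κ M : ℝ) (n : ℕ) : ℕ := chiStar κ M n (1 / 3 * sinSq ε κ)

/-- `A(n) = exp((⌈1/cos(M√κ)⌉ (Γ(n) - 1 + max{S, 1}) + 1) ln 4) + 1` -/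
def boundA (ε κ M : ℝ) (n : ℕ) : ℕ :=
  4 ^ (secCeil κ M * (Gam ε κ M n - 1 + maxS ε κ M) + 1) + 1

/-- The rate of metastability `Σ(ε, g, κ, M) = A(F^B(0) + ⌈1/ε₀⌉)`, where `F^B` is the `B`-th iterate
of `F(i) = i + f*(i)`. -/
def SigmaRate (ε : ℝ) (g : ℕ → ℕ) (κ M : ℝ) : ℕ :=
  boundA ε κ M ((fStarTilde ε g κ M)^[boundB ε κ M] 0 + ⌈1 / eps0 ε κ M⌉₊)

end HalpernCAT

end

/-!
The metric is scaled by `√κ`, so that the curvature bound is `1` and the diameter of `C` is at most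
`a = M √κ < π / 2`. If `M ≤ ε` there is nothing to prove.

All geometry comes from one comparison, `HingeInequality`: for points `z`, `z'` on the two arms of a
hinge, the spherical cosine law with the comparison angle of the hinge bounds `cos d(z, z')` from
below. It is the CAT inequality with the comparison triangle written in polar coordinates around the
vertex of the hinge. Convex combinations are unique as a consequence.

Let `z_i` be the resolvents, `z_i = u / (i + 1) + (1 - 1 / (i + 1)) T z_i`, which are fixed points of
contractions. Three facts about them carry the proof.

* The angle at `z_i` between `u` and an almost fixed point `p` is almost obtuse:
  `cos d(u, p) ≤ cos d(u, z_i) cos d(z_i, p) + (i + 1) d(p, T p)` (`cos_dist_le_of_resolvent`).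
* For `i < m` the angle at `z_i` between `u` and `z_m` is obtuse (`resolvent_obtuse`). Hence
  `d(u, z_i)` increases with `i`, and `z_i` and `z_m` are close as soon as these distances are. As
  they lie in `[0, a]`, one of `B` consecutive increments along `F^j(0) + ⌈1/ε₀⌉` is small, which
  gives indices `i ≤ m` with `d(z_i, z_m) ≤ ε₀` and `m` as large with respect to `i` as required.
* For the Halpern iterates, `1 - cos d(z_m, x_n)` contracts in each step by `1 - λ_{n+1} cos a`
  towards a multiple of the error in the first fact (`one_sub_cos_step`), apart from a perturbation
  of size `d(z_m, T z_m) ≤ a / (m + 1)`, which is negligible over the relevant range of `n`.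

The error in the first fact is small from `χ*_i` on, by asymptotic regularity
(`dist_apply_le_of_chi_le`). So `x_n` is within `ε / 2` of `z_m` for `n` between `Θ_i` and
`Θ_i + g(Θ_i)`, and `N = Θ_i` works. The bound `Σ` has `S` in place of the possibly larger `T_δ` of
`Θ_i`; it dominates `Θ_i` nevertheless, because it is evaluated at an index above `i` and `χ*` grows at
least by the factor `4` with each index (`Theta_le_boundA`).
-/

namespace HalpernCAT

/-! ### Comparison triangles in polar coordinates -/

/-- The point of the unit sphere with polar distance `θ` from the pole `(1, 0, 0)` and
longitude `φ`. -/
noncomputable def polarPoint (θ φ : ℝ) : ModelSpace :=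
  ⟨!₂[Real.cos θ, Real.sin θ * Real.cos φ, Real.sin θ * Real.sin φ], by
    rw [mem_sphere_zero_iff_norm, EuclideanSpace.norm_eq, Real.sqrt_eq_one]
    simp only [Real.norm_eq_abs, sq_abs, Fin.sum_univ_three]
    simp
    linear_combination Real.sin_sq_add_cos_sq θ + Real.sin θ ^ 2 * Real.sin_sq_add_cos_sq φ⟩

theorem modelDist_polarPoint (κ θ φ θ' φ' : ℝ) :
    modelDist κ (polarPoint θ φ) (polarPoint θ' φ') =
      Real.arccos (Real.cos (θ - θ') - Real.sin θ * Real.sin θ' * (1 - Real.cos (φ - φ'))) /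
        √κ := by
  simp only [modelDist, polarPoint, PiLp.inner_apply, Fin.sum_univ_three]
  congr 2
  simp [Real.cos_sub]
  ring

theorem modelDist_comm (κ : ℝ) (p q : ModelSpace) : modelDist κ p q = modelDist κ q p := by
  simp only [modelDist, real_inner_comm]

theorem modelDist_polarPoint_same (κ θ θ' φ d : ℝ) (hκ : 0 < κ) (h : |θ - θ'| = √κ * d)
    (hpi : |θ - θ'| ≤ Real.pi) :
    modelDist κ (polarPoint θ φ) (polarPoint θ' φ) = d := by
  rw [modelDist_polarPoint, sub_self, Real.cos_zero, sub_self, mul_zero, sub_zero,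
    ← Real.cos_abs, Real.arccos_cos (abs_nonneg _) hpi, h]
  field_simp

/-- The longitude difference `γ` of the two outer vertices of a comparison triangle enters the
cosine law through `k = 1 - cos γ`; this is the value it must have. -/
theorem exists_versine {a b c : ℝ} (ha : 0 < a) (hb : 0 < b) (ha' : a < Real.pi / 2)
    (hb' : b < Real.pi / 2) (hc : 0 ≤ c) (hcab : c ≤ a + b) (hab : |a - b| ≤ c) :
    ∃ k, 0 ≤ k ∧ k ≤ 2 ∧ Real.cos c = Real.cos (a - b) - Real.sin a * Real.sin b * k := by
  have hsa : 0 < Real.sin a := Real.sin_pos_of_pos_of_lt_pi ha (by linarith)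
  have hsb : 0 < Real.sin b := Real.sin_pos_of_pos_of_lt_pi hb (by linarith)
  have hs : 0 < Real.sin a * Real.sin b := mul_pos hsa hsb
  refine ⟨(Real.cos (a - b) - Real.cos c) / (Real.sin a * Real.sin b), ?_, ?_, ?_⟩
  · refine div_nonneg ?_ hs.le
    rw [← Real.cos_abs (a - b)]
    have := Real.cos_le_cos_of_nonneg_of_le_pi (abs_nonneg (a - b)) (by linarith) hab
    linarith
  · rw [div_le_iff₀ hs]
    have := Real.cos_le_cos_of_nonneg_of_le_pi hc (by linarith) hcab
    rw [Real.cos_add] at this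
    rw [Real.cos_sub]
    linarith
  · field_simp
    ring

section Hinge

variable {X : Type*} [MetricSpace X] {κ : ℝ}

theorem IsGeodesicPath.isConvexCombination {x y : X} {c : ℝ → X} (hc : IsGeodesicPath x y c) {s : ℝ}
    (hs : s ∈ Set.Icc (0 : ℝ) 1) : IsConvexCombination x y s (c (s * dist x y)) := by
  have hd : 0 ≤ dist x y := dist_nonneg
  have h1 : s * dist x y ∈ Set.Icc 0 (dist x y) :=
    ⟨mul_nonneg hs.1 hd, mul_le_of_le_one_left hd hs.2⟩
  constructor
  · have := hc.isometric _ h1 0 ⟨le_rfl, hd⟩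
    rwa [hc.source, sub_zero, abs_of_nonneg h1.1] at this
  · have := hc.isometric _ h1 _ ⟨hd, le_rfl⟩
    rw [hc.target, abs_sub_comm, abs_of_nonneg (by linarith [h1.2])] at this
    rw [this]
    ring

/-- The conclusion of the hinge comparison: for a hinge at `u` with outer endpoints `y`, `y'` and
points `z`, `z'` at fractions `s`, `s'` of its arms, the spherical cosine law holds with equality for
the endpoints and as an estimate for `z`, `z'`, with the same value `k = 1 - cos γ`. The factor
`r = √κ` normalizes the curvature to `1`. -/
def HingeInequality (r : ℝ) (u y y' z z' : X) (s s' : ℝ) : Prop :=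
  ∃ k, 0 ≤ k ∧
    Real.cos (r * dist y y') = Real.cos (r * dist u y - r * dist u y') -
      Real.sin (r * dist u y) * Real.sin (r * dist u y') * k ∧
    Real.cos (s * (r * dist u y) - s' * (r * dist u y')) -
      Real.sin (s * (r * dist u y)) * Real.sin (s' * (r * dist u y')) * k ≤ Real.cos (r * dist z z')

theorem hinge_of_geodesics (hκ : 0 < κ) (hX : IsCATSpace κ X) {u y y' : X}
    (hy : √κ * dist u y < Real.pi / 2) (hy' : √κ * dist u y' < Real.pi / 2)
    (hyy' : √κ * dist y y' < Real.pi / 2) {c c' : ℝ → X} (hc : IsGeodesicPath u y c)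
    (hc' : IsGeodesicPath y' u c') {s s' : ℝ} (hs : s ∈ Set.Icc (0 : ℝ) 1)
    (hs' : s' ∈ Set.Icc (0 : ℝ) 1) :
    HingeInequality √κ u y y' (c (s * dist u y)) (c' ((1 - s') * dist y' u)) s s' := by
  have hr : 0 < √κ := Real.sqrt_pos.2 hκ
  set r := √κ with hrdef
  have hz := IsGeodesicPath.isConvexCombination hc hs
  have hz' := IsGeodesicPath.isConvexCombination hc' (s := 1 - s') ⟨by linarith [hs'.2], by linarith [hs'.1]⟩
  rcases eq_or_ne u y with rfl | hne
  · have h0 : dist (c (s * dist u u)) u = 0 := by rw [hz.1]; simp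
    refine ⟨0, le_rfl, by simp, ?_⟩
    rw [dist_eq_zero.1 h0, dist_comm u (c' _), hz'.2]
    simp only [dist_self, mul_zero, zero_sub, Real.cos_neg, sub_zero, dist_comm y' u]
    apply le_of_eq; congr 1; ring
  rcases eq_or_ne u y' with rfl | hne'
  · have h0 : dist (c' ((1 - s') * dist u u)) u = 0 := by rw [hz'.1]; simp
    refine ⟨0, le_rfl, by simp [dist_comm], ?_⟩
    rw [dist_eq_zero.1 h0, hz.1]
    simp only [dist_self, mul_zero, sub_zero]
    apply le_of_eq; congr 1; ring
  set A := r * dist u y with hA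
  set B := r * dist u y' with hB
  have hA0 : 0 < A := mul_pos hr (dist_pos.2 hne)
  have hB0 : 0 < B := mul_pos hr (dist_pos.2 hne')
  have hE0 : 0 ≤ r * dist y y' := mul_nonneg hr.le dist_nonneg
  have hpi := Real.pi_pos
  have habs : |A - B| ≤ r * dist y y' := by
    rw [hA, hB, ← mul_sub, abs_mul, abs_of_pos hr, dist_comm u y, dist_comm u y']
    exact mul_le_mul_of_nonneg_left (abs_dist_sub_le y y' u) hr.le
  obtain ⟨k, hk0, hk2, hk⟩ := exists_versine hA0 hB0 hy hy' hE0
    (by rw [hA, hB, ← mul_add, dist_comm u y]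
        exact mul_le_mul_of_nonneg_left (dist_triangle y u y') hr.le) habs
  refine ⟨k, hk0, hk, ?_⟩
  obtain ⟨e, he⟩ := hX.exists_geodesic y y' (by
    rw [modelDiam, lt_div_iff₀ hr]; nlinarith)
  set γ := Real.arccos (1 - k) with hγ
  have hcosγ : 1 - Real.cos (-γ) = k := by
    rw [Real.cos_neg, hγ, Real.cos_arccos (by linarith) (by linarith)]; ring
  have hsA : s * A ∈ Set.Icc 0 A := ⟨mul_nonneg hs.1 hA0.le, mul_le_of_le_one_left hA0.le hs.2⟩
  have hsB : s' * B ∈ Set.Icc 0 B := ⟨mul_nonneg hs'.1 hB0.le, mul_le_of_le_one_left hB0.le hs'.2⟩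
  have hpole : ∀ φ, polarPoint 0 φ = polarPoint 0 0 := by
    intro φ; apply Subtype.ext; simp [polarPoint]
  have h01 : modelDist κ (polarPoint 0 0) (polarPoint A 0) = dist u y :=
    modelDist_polarPoint_same κ _ _ _ _ hκ (by rw [zero_sub, abs_neg, abs_of_pos hA0])
      (by rw [zero_sub, abs_neg, abs_of_pos hA0]; linarith)
  have h02 : modelDist κ (polarPoint 0 0) (polarPoint B γ) = dist u y' := by
    rw [← hpole γ]
    exact modelDist_polarPoint_same κ _ _ _ _ hκ (by rw [zero_sub, abs_neg, abs_of_pos hB0])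
      (by rw [zero_sub, abs_neg, abs_of_pos hB0]; linarith)
  have h12 : modelDist κ (polarPoint A 0) (polarPoint B γ) = dist y y' := by
    rw [modelDist_polarPoint, zero_sub, hcosγ, ← hk, Real.arccos_cos hE0 (by linarith)]
    exact mul_div_cancel_left₀ _ hr.ne'
  have hself : ∀ θ φ, modelDist κ (polarPoint θ φ) (polarPoint θ φ) = 0 := fun θ φ =>
    modelDist_polarPoint_same κ _ _ _ _ hκ (by simp) (by simp [hpi.le])
  have htri : IsGeodesicTriangle ![u, y, y'] ![c, e, c'] := by
    constructor
    intro i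
    fin_cases i
    · exact hc
    · exact he
    · exact hc'
  have hineq := hX.cat_inequality _ _ htri (by
    have h2 : 2 * modelDiam κ = (2 * Real.pi) / r := by rw [modelDiam]; ring
    rw [h2, lt_div_iff₀ hr]
    have : dist y' u = dist u y' := dist_comm _ _
    simp only [Matrix.cons_val_zero, Matrix.cons_val_one, Matrix.cons_val]
    rw [this]
    nlinarith)
  have hcomp : IsComparisonTriangle κ ![u, y, y']
      ![polarPoint 0 0, polarPoint A 0, polarPoint B γ] := by
    intro i j
    fin_cases i <;> fin_cases j
    · simpa using hself 0 0
    · exact h01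
    · exact h02
    · exact (modelDist_comm κ _ _).trans (h01.trans (dist_comm _ _))
    · simpa using hself A 0
    · exact h12
    · exact (modelDist_comm κ _ _).trans (h02.trans (dist_comm _ _))
    · exact (modelDist_comm κ _ _).trans (h12.trans (dist_comm _ _))
    · simpa using hself B γ
  have hfin := hineq _ hcomp 0 2 (s * dist u y)
    ⟨mul_nonneg hs.1 dist_nonneg, mul_le_of_le_one_left dist_nonneg hs.2⟩
    ((1 - s') * dist y' u)
    ⟨mul_nonneg (by linarith [hs'.2]) dist_nonneg,
      mul_le_of_le_one_left dist_nonneg (by linarith [hs'.1])⟩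
    (polarPoint (s * A) 0) (polarPoint (s' * B) γ)
    ⟨modelDist_polarPoint_same κ _ _ _ _ hκ
        (by rw [zero_sub, abs_neg, abs_of_nonneg hsA.1, hA]; ring)
        (by rw [zero_sub, abs_neg, abs_of_nonneg hsA.1]; linarith [hsA.2]),
      modelDist_polarPoint_same κ _ _ _ _ hκ
        (by
          rw [abs_sub_comm, abs_of_nonneg (by linarith [hsA.2])]
          change A - s * A = r * (dist u y - s * dist u y)
          rw [hA]; ring)
        (by rw [abs_sub_comm, abs_of_nonneg (by linarith [hsA.2])]; linarith [hsA.1])⟩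
    ⟨modelDist_polarPoint_same κ _ _ _ _ hκ
        (by rw [abs_of_nonneg (by linarith [hsB.2]), hB, dist_comm y' u]; ring)
        (by rw [abs_of_nonneg (by linarith [hsB.2])]; linarith [hsB.1]),
      by
        change modelDist κ _ (polarPoint 0 0) = dist y' u - (1 - s') * dist y' u
        rw [← hpole γ]
        exact modelDist_polarPoint_same κ _ _ _ _ hκ
          (by rw [sub_zero, abs_of_nonneg hsB.1, hB, dist_comm y' u]; ring)
          (by rw [sub_zero, abs_of_nonneg hsB.1]; linarith [hsB.2])⟩
  rw [modelDist_polarPoint, zero_sub, hcosγ, le_div_iff₀ hr, mul_comm] at hfin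
  change r * dist (c (s * dist u y)) (c' ((1 - s') * dist y' u)) ≤ _ at hfin
  have hcos := Real.cos_le_cos_of_nonneg_of_le_pi (mul_nonneg hr.le dist_nonneg)
    (Real.arccos_le_pi _) hfin
  -- The cosine law for the comparison points takes its value in `[-1, 1]`.
  have hlaw : Real.cos (s * A - s' * B) - Real.sin (s * A) * Real.sin (s' * B) * k ≤ 1 ∧
      -1 ≤ Real.cos (s * A - s' * B) - Real.sin (s * A) * Real.sin (s' * B) * k := by
    have h1 : 0 ≤ Real.sin (s * A) * Real.sin (s' * B) :=
      mul_nonneg (Real.sin_nonneg_of_nonneg_of_le_pi hsA.1 (by linarith [hsA.2]))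
        (Real.sin_nonneg_of_nonneg_of_le_pi hsB.1 (by linarith [hsB.2]))
    have h2 := Real.cos_le_one (s * A - s' * B)
    have h3 := Real.neg_one_le_cos (s * A + s' * B)
    rw [Real.cos_add] at h3
    constructor
    · nlinarith
    · rw [Real.cos_sub]; nlinarith
  rwa [Real.cos_arccos hlaw.2 hlaw.1] at hcos

theorem exists_geodesic_of_lt (hκ : 0 < κ) (hX : IsCATSpace κ X) {x y : X}
    (h : √κ * dist x y < Real.pi / 2) : ∃ c : ℝ → X, IsGeodesicPath x y c := by
  have hr : 0 < √κ := Real.sqrt_pos.2 hκ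
  refine hX.exists_geodesic x y ?_
  rw [modelDiam, lt_div_iff₀ hr]
  nlinarith [Real.pi_pos]

/-- Short geodesics are unique: a point dividing a pair of points in the ratio `s : 1 - s` lies on
every geodesic between them. -/
theorem convexCombination_eq_geodesic (hκ : 0 < κ) (hX : IsCATSpace κ X) {x y z : X}
    (h : √κ * dist x y < Real.pi / 2) {s : ℝ} (hs : s ∈ Set.Icc (0 : ℝ) 1)
    (hz : IsConvexCombination x y s z) {c : ℝ → X} (hc : IsGeodesicPath x y c) :
    z = c (s * dist x y) := by
  have hr : 0 < √κ := Real.sqrt_pos.2 hκ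
  have hD : 0 ≤ √κ * dist x y := mul_nonneg hr.le dist_nonneg
  have hxz : √κ * dist x z = s * (√κ * dist x y) := by rw [dist_comm, hz.1]; ring
  have hyz : √κ * dist y z = (1 - s) * (√κ * dist x y) := by rw [dist_comm, hz.2]; ring
  have hpi := Real.pi_pos
  have hxz' : √κ * dist x z < Real.pi / 2 := by rw [hxz]; nlinarith [hs.2]
  have hyz' : √κ * dist y z < Real.pi / 2 := by rw [hyz]; nlinarith [hs.1]
  obtain ⟨e, he⟩ := exists_geodesic_of_lt hκ hX (x := z) (y := x) (by rwa [dist_comm])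
  obtain ⟨k, hk0, hk, hle⟩ := hinge_of_geodesics hκ hX h hxz' hyz' hc he hs
    (s' := 1) ⟨zero_le_one, le_rfl⟩
  rw [sub_self, zero_mul, he.source, hxz] at hle
  rw [hyz, hxz] at hk
  set A := √κ * dist x y
  rw [one_mul, sub_self, Real.cos_zero] at hle
  have hAs : A - s * A = (1 - s) * A := by ring
  rw [hAs] at hk
  have hss : 0 ≤ Real.sin (s * A) :=
    Real.sin_nonneg_of_nonneg_of_le_pi (mul_nonneg hs.1 hD) (by nlinarith [hs.2])
  have hmono : Real.sin (s * A) ≤ Real.sin A :=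
    Real.sin_le_sin_of_le_of_le_pi_div_two (by nlinarith [mul_nonneg hs.1 hD]) h.le
      (by nlinarith [hs.2])
  have hk1 : Real.sin (s * A) * Real.sin (s * A) * k ≤ 0 := by
    have : Real.sin A * Real.sin (s * A) * k = 0 := by linarith
    rw [← this]
    gcongr
  have h1 : 1 ≤ Real.cos (√κ * dist (c (s * dist x y)) z) := by linarith
  have h2 : dist (c (s * dist x y)) z ≤ dist x z + dist x y := by
    have := dist_triangle (c (s * dist x y)) x z
    have h3 := (IsGeodesicPath.isConvexCombination hc hs).1
    have : s * dist x y ≤ dist x y := mul_le_of_le_one_left dist_nonneg hs.2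
    linarith
  have h3 : √κ * dist (c (s * dist x y)) z = 0 := by
    have h4 : √κ * dist (c (s * dist x y)) z ≤ √κ * dist x z + √κ * dist x y := by
      rw [← mul_add]; exact mul_le_mul_of_nonneg_left h2 hr.le
    have h5 : 0 ≤ √κ * dist (c (s * dist x y)) z := mul_nonneg hr.le dist_nonneg
    exact (Real.cos_eq_one_iff_of_lt_of_lt (by linarith) (by linarith)).1
      (le_antisymm (Real.cos_le_one _) h1)
  have h4 : dist (c (s * dist x y)) z = 0 := by
    rcases mul_eq_zero.1 h3 with h | h
    · exact absurd h hr.ne'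
    · exact h
  exact (dist_eq_zero.1 h4).symm

theorem hinge_of_convexCombinations (hκ : 0 < κ) (hX : IsCATSpace κ X) {u y y' z z' : X}
    (hy : √κ * dist u y < Real.pi / 2) (hy' : √κ * dist u y' < Real.pi / 2)
    (hyy' : √κ * dist y y' < Real.pi / 2) {s s' : ℝ} (hs : s ∈ Set.Icc (0 : ℝ) 1)
    (hs' : s' ∈ Set.Icc (0 : ℝ) 1) (hz : IsConvexCombination u y s z)
    (hz' : IsConvexCombination u y' s' z') : HingeInequality √κ u y y' z z' s s' := by
  obtain ⟨c, hc⟩ := exists_geodesic_of_lt hκ hX hy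
  have hy'' : √κ * dist y' u < Real.pi / 2 := by rwa [dist_comm]
  obtain ⟨c', hc'⟩ := exists_geodesic_of_lt hκ hX hy''
  have hz'' : IsConvexCombination y' u (1 - s') z' :=
    ⟨by rw [hz'.2, dist_comm], by rw [hz'.1, dist_comm]; ring⟩
  rw [convexCombination_eq_geodesic hκ hX hy hs hz hc,
    convexCombination_eq_geodesic hκ hX hy'' ⟨by linarith [hs'.2], by linarith [hs'.1]⟩ hz'' hc']
  exact hinge_of_geodesics hκ hX hy hy' hyy' hc hc' hs hs'

end Hinge

/-! ### Small uniquely geodesic spaces with hinge comparison -/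

/-- What is used of a convex subset of diameter at most `a / r < π / (2 r)` of a `CAT(r²)` space,
viewed as a metric space in its own right: the diameter bound, the existence of convex combinations,
and the comparison of hinges with the unit sphere after scaling the metric by `r`. -/
structure IsSmallCATDomain (r a : ℝ) (Y : Type*) [MetricSpace Y] : Prop where
  scale_pos : 0 < r
  bound_lt : a < Real.pi / 2
  dist_le : ∀ x y : Y, r * dist x y ≤ a
  exists_comb : ∀ (x y : Y) (s : ℝ), s ∈ Set.Icc (0 : ℝ) 1 → ∃ z, IsConvexCombination x y s z
  hinge : ∀ (u y y' z z' : Y) (s s' : ℝ), s ∈ Set.Icc (0 : ℝ) 1 → s' ∈ Set.Icc (0 : ℝ) 1 →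
    IsConvexCombination u y s z → IsConvexCombination u y' s' z' →
      HingeInequality r u y y' z z' s s'

theorem isSmallCATDomain_of_convex {X : Type*} [MetricSpace X] {κ : ℝ} (hκ : 0 < κ)
    (hX : IsCATSpace κ X) {C : Set X} (hCb : Bornology.IsBounded C)
    (hC : IsGeodesicallyConvex C) {M : ℝ} (hCM : Metric.diam C ≤ M) (hM : M < modelDiam κ / 2) :
    IsSmallCATDomain √κ (M * √κ) C := by
  have hr : 0 < √κ := Real.sqrt_pos.2 hκ
  have ha : M * √κ < Real.pi / 2 := by
    rw [modelDiam, div_div, lt_div_iff₀ (by positivity)] at hM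
    linarith
  have hd : ∀ x ∈ C, ∀ y ∈ C, √κ * dist x y ≤ M * √κ := fun x hx y hy => by
    rw [mul_comm]
    exact mul_le_mul_of_nonneg_right ((Metric.dist_le_diam_of_mem hCb hx hy).trans hCM) hr.le
  refine ⟨hr, ha, fun x y => hd x x.2 y y.2, fun x y s hs => ?_, ?_⟩
  · obtain ⟨c, hc⟩ := exists_geodesic_of_lt hκ hX ((hd x x.2 y y.2).trans_lt ha)
    have hmem : s * dist (x : X) y ∈ Set.Icc 0 (dist (x : X) y) :=
      ⟨mul_nonneg hs.1 dist_nonneg, mul_le_of_le_one_left dist_nonneg hs.2⟩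
    exact ⟨⟨c (s * dist (x : X) y), hC x x.2 y y.2 c hc ⟨_, hmem, rfl⟩⟩, IsGeodesicPath.isConvexCombination hc hs⟩
  · intro u y y' z z' s s' hs hs' hz hz'
    exact hinge_of_convexCombinations hκ hX ((hd u u.2 y y.2).trans_lt ha)
      ((hd u u.2 y' y'.2).trans_lt ha) ((hd y y.2 y' y'.2).trans_lt ha) hs hs'
      (u := (u : X)) (z := z) (z' := z') hz hz'

/-! ### Trigonometric estimates -/

theorem mul_sin_le_sin_mul {t D : ℝ} (ht : t ∈ Set.Icc (0 : ℝ) 1) (hD : 0 ≤ D)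
    (hD' : D ≤ Real.pi) : t * Real.sin D ≤ Real.sin (t * D) := by
  have := strictConcaveOn_sin_Icc.concaveOn.2
    (⟨le_rfl, Real.pi_pos.le⟩ : (0 : ℝ) ∈ Set.Icc 0 Real.pi) (⟨hD, hD'⟩ : D ∈ Set.Icc 0 Real.pi)
    (by linarith [ht.2] : (0 : ℝ) ≤ 1 - t) ht.1 (by ring)
  simpa using this

theorem sin_mul_le {a A s : ℝ} (ha : a < Real.pi / 2) (hA : 0 ≤ A) (hAa : A ≤ a)
    (hs : s ∈ Set.Icc (0 : ℝ) 1) :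
    Real.sin (s * A) ≤ (1 - (1 - s) * Real.cos a) * Real.sin A := by
  have hpi := Real.pi_pos
  have hsin : 0 ≤ Real.sin A := Real.sin_nonneg_of_nonneg_of_le_pi hA (by linarith)
  have hcos : Real.cos a ≤ Real.cos A := Real.cos_le_cos_of_nonneg_of_le_pi hA (by linarith) hAa
  have hca : 0 ≤ Real.cos A := Real.cos_nonneg_of_neg_pi_div_two_le_of_le (by linarith) (by linarith)
  have h1 : 0 ≤ (1 - s) * A := mul_nonneg (by linarith [hs.2]) hA
  -- `sin (A - x) = sin A cos x - cos A sin x` with `x = (1 - s) A`, and `sin A ≤ A`.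
  have h2 : s * A = A - (1 - s) * A := by ring
  rw [h2, Real.sin_sub]
  have hx : (1 - s) * A ≤ A := mul_le_of_le_one_left hA (by linarith [hs.1])
  have h3 : (1 - s) * Real.sin A ≤ Real.sin ((1 - s) * A) :=
    mul_sin_le_sin_mul ⟨by linarith [hs.2], by linarith [hs.1]⟩ hA (by linarith)
  have h4 : (1 - s) * Real.sin A * Real.cos a ≤ Real.cos A * Real.sin ((1 - s) * A) := by
    have : 0 ≤ (1 - s) * Real.sin A := mul_nonneg (by linarith [hs.2]) hsin
    nlinarith
  nlinarith [Real.cos_le_one ((1 - s) * A)]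

theorem cos_le_cos_add {x y t : ℝ} (ht : 0 ≤ t) (h : y ≤ x + t)
    (hy0 : 0 ≤ y) (hx' : x ≤ Real.pi) : Real.cos x ≤ Real.cos y + t := by
  rcases le_total y x with hyx | hxy
  · linarith [Real.cos_le_cos_of_nonneg_of_le_pi hy0 hx' hyx]
  · have h1 := Real.abs_cos_sub_cos_le x y
    rw [abs_sub_comm x y, abs_of_nonneg (by linarith : 0 ≤ y - x)] at h1
    linarith [le_abs_self (Real.cos x - Real.cos y)]

theorem one_sub_cos_mul_le {ρ x y : ℝ}
    (h : Real.sin (y / 2) ≤ ρ * Real.sin (x / 2)) (hy : 0 ≤ Real.sin (y / 2)) :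
    1 - Real.cos y ≤ ρ ^ 2 * (1 - Real.cos x) := by
  have h1 : ∀ z : ℝ, 1 - Real.cos z = 2 * Real.sin (z / 2) ^ 2 := fun z => by
    have := Real.sin_sq_eq_half_sub (z / 2)
    rw [mul_div_cancel₀ z two_ne_zero] at this
    linarith
  rw [h1, h1]
  have := mul_self_le_mul_self hy h
  nlinarith

/-- The planar inequality behind the obtuse angle estimate. Two points at polar distances `α`, `β`
on rays that enclose an angle with versine `k` have a spherical distance which does not increase
when they are moved outwards by `α / i` and `β / m`, only if `α ≤ β` and the angle at the first
point, between the pole and the second point, is at least a right one. -/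
theorem obtuse_of_dist_le {a b α β k i m : ℝ} (hα : 0 ≤ α) (hβ : 0 ≤ β) (hk : 0 ≤ k)
    (hi : 0 < i) (hm : i < m) (ha : a = α + α / i) (hb : b = β + β / m)
    (ha' : a < Real.pi / 2) (hb' : b < Real.pi / 2)
    (h : Real.cos (α - β) - Real.sin α * Real.sin β * k ≤
      Real.cos (a - b) - Real.sin a * Real.sin b * k) :
    α ≤ β ∧ Real.cos β ≤ Real.cos α * (Real.cos (α - β) - Real.sin α * Real.sin β * k) := by
  have hm0 : 0 < m := hi.trans hm
  have hpi := Real.pi_pos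
  set p := α / i with hp
  set q := β / m with hq
  have hp0 : 0 ≤ p := div_nonneg hα hi.le
  have hq0 : 0 ≤ q := div_nonneg hβ hm0.le
  have hsα : 0 ≤ Real.sin α := Real.sin_nonneg_of_nonneg_of_le_pi hα (by linarith)
  have hsβ : 0 ≤ Real.sin β := Real.sin_nonneg_of_nonneg_of_le_pi hβ (by linarith)
  have hsαa : Real.sin α ≤ Real.sin a :=
    Real.sin_le_sin_of_le_of_le_pi_div_two (by linarith) ha'.le (by linarith)
  have hsβb : Real.sin β ≤ Real.sin b :=
    Real.sin_le_sin_of_le_of_le_pi_div_two (by linarith) hb'.le (by linarith)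
  have hprod : Real.sin α * Real.sin β ≤ Real.sin a * Real.sin b := by gcongr; linarith
  have hcos : Real.cos (α - β) ≤ Real.cos (a - b) := by nlinarith
  have habs : |a - b| ≤ |α - β| := by
    by_contra! hlt
    rw [← Real.cos_abs (α - β), ← Real.cos_abs (a - b)] at hcos
    have : |a - b| ≤ Real.pi := abs_le.2 ⟨by linarith, by linarith⟩
    exact absurd hcos (not_le.2 (Real.cos_lt_cos_of_nonneg_of_le_pi (abs_nonneg _) this hlt))
  have hαβ : α ≤ β := by
    by_contra! hlt
    have hqp : q < p := by
      rw [hq, hp, div_lt_div_iff₀ hm0 hi]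
      nlinarith
    rw [abs_of_pos (by linarith : 0 < α - β), abs_of_pos (by linarith : 0 < a - b)] at habs
    linarith
  refine ⟨hαβ, ?_⟩
  rw [abs_sub_comm α β, abs_of_nonneg (by linarith : 0 ≤ β - α), abs_le] at habs
  have hqp : q ≤ p := by linarith
  have hsum : a + α ≤ b + β := by linarith
  rcases hα.eq_or_lt with h0 | hα0
  · rw [← h0]; simp
  have hβ0 : 0 < β := hα0.trans_le hαβ
  have hsα0 : 0 < Real.sin α := Real.sin_pos_of_pos_of_lt_pi hα0 (by linarith)
  have hsβ0 : 0 < Real.sin β := Real.sin_pos_of_pos_of_lt_pi hβ0 (by linarith)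
  have hstrict : Real.sin α * Real.sin β < Real.sin a * Real.sin b := by
    have : Real.sin α < Real.sin a :=
      Real.sin_lt_sin_of_lt_of_le_pi_div_two (by linarith) ha'.le
        (by have : 0 < p := div_pos hα0 hi
            linarith)
    calc Real.sin α * Real.sin β < Real.sin a * Real.sin β := by gcongr
      _ ≤ Real.sin a * Real.sin b := by gcongr; linarith
  -- The wanted inequality for the largest `k` that the hypothesis allows. It says
  -- `cos p sin (2β + q) - cos (2α + p) sin q ≤ sin 2β`, with equality if `p = q` and `α = β`.
  have key : Real.cos a * Real.cos b * (Real.cos α * Real.sin β) +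
      Real.sin a * Real.sin b * (Real.sin α * Real.cos β) ≤ Real.sin β * Real.cos β := by
    have e1 : Real.cos α * Real.cos a = (Real.cos p + Real.cos (a + α)) / 2 := by
      have : p = a - α := by rw [ha]; ring
      rw [this, Real.cos_sub, Real.cos_add]; ring
    have e2 : Real.sin α * Real.sin a = (Real.cos p - Real.cos (a + α)) / 2 := by
      have : p = a - α := by rw [ha]; ring
      rw [this, Real.cos_sub, Real.cos_add]; ring
    have e3 : Real.sin (b + β) = Real.sin b * Real.cos β + Real.cos b * Real.sin β :=
      Real.sin_add _ _
    have e4 : Real.sin q = Real.sin b * Real.cos β - Real.cos b * Real.sin β := by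
      have : q = b - β := by rw [hb]; ring
      rw [this, Real.sin_sub]
    have e5 : 2 * (Real.sin β * Real.cos β) =
        Real.cos q * Real.sin (b + β) - Real.cos (b + β) * Real.sin q := by
      have : 2 * β = (b + β) - q := by rw [hb]; ring
      rw [mul_comm (Real.cos q), ← Real.sin_sub, ← this, Real.sin_two_mul]; ring
    have c1 : Real.cos p ≤ Real.cos q :=
      Real.cos_le_cos_of_nonneg_of_le_pi hq0 (by linarith) hqp
    have c2 : Real.cos (b + β) ≤ Real.cos (a + α) :=
      Real.cos_le_cos_of_nonneg_of_le_pi (by linarith) (by linarith) hsum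
    have c3 : 0 ≤ Real.sin (b + β) :=
      Real.sin_nonneg_of_nonneg_of_le_pi (by linarith) (by linarith)
    have c4 : 0 ≤ Real.sin q := Real.sin_nonneg_of_nonneg_of_le_pi hq0 (by linarith)
    have e6 : Real.cos a * Real.cos b * (Real.cos α * Real.sin β) +
        Real.sin a * Real.sin b * (Real.sin α * Real.cos β) =
        (Real.cos p * Real.sin (b + β) - Real.cos (a + α) * Real.sin q) / 2 := by
      rw [e3, e4]
      linear_combination (Real.cos b * Real.sin β) * e1 + (Real.sin b * Real.cos β) * e2
    rw [e6]
    nlinarith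
  have hW : 0 < Real.sin a * Real.sin b - Real.sin α * Real.sin β := by linarith
  have hP := Real.sin_sq_add_cos_sq α
  rw [Real.cos_sub, Real.cos_sub] at h
  rw [Real.cos_sub]
  refine le_of_mul_le_mul_right ?_ hW
  have hca : 0 ≤ Real.cos α :=
    Real.cos_nonneg_of_neg_pi_div_two_le_of_le (by linarith) (by linarith)
  -- With `x = cos γ = 1 - k`, the hypothesis bounds `x (sin a sin b - sin α sin β)` from below.
  have h' : Real.cos α * Real.cos β - Real.cos a * Real.cos b ≤
      (1 - k) * (Real.sin a * Real.sin b - Real.sin α * Real.sin β) := by linarith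
  have h2 := mul_le_mul_of_nonneg_left h' (mul_nonneg (mul_nonneg hca hsα0.le) hsβ0.le)
  have h3 := mul_le_mul_of_nonneg_left key hsα0.le
  linear_combination h2 + h3 - (Real.sin α * Real.sin β * Real.cos β +
    Real.cos β * (Real.sin a * Real.sin b - Real.sin α * Real.sin β)) * hP

/-! ### One-point comparison, contraction and resolvents -/

section Domain

variable {Y : Type*} [MetricSpace Y] {r a : ℝ}

theorem IsSmallCATDomain.mul_dist_nonneg (hY : IsSmallCATDomain r a Y) (x y : Y) :
    0 ≤ r * dist x y := mul_nonneg hY.scale_pos.le dist_nonneg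

theorem IsSmallCATDomain.mul_dist_triangle (hY : IsSmallCATDomain r a Y) (x y z : Y) :
    r * dist x z ≤ r * dist x y + r * dist y z := by
  rw [← mul_add]; exact mul_le_mul_of_nonneg_left (dist_triangle x y z) hY.scale_pos.le

/-- On the unit sphere, the point `(1 - s) x + s y` of the great circle arc of length `D` from `x` to
`y` is the linear combination of `x` and `y` with coefficients `sin ((1 - s) D) / sin D` and
`sin (s D) / sin D`, and this is an equality of inner products with `w`. -/
theorem IsSmallCATDomain.cos_dist_comb (hY : IsSmallCATDomain r a Y) {x y z : Y} {s : ℝ}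
    (hs : s ∈ Set.Icc (0 : ℝ) 1) (hz : IsConvexCombination x y s z) (w : Y) :
    Real.sin ((1 - s) * (r * dist x y)) * Real.cos (r * dist x w) +
      Real.sin (s * (r * dist x y)) * Real.cos (r * dist y w) ≤
        Real.sin (r * dist x y) * Real.cos (r * dist z w) := by
  obtain ⟨k, hk0, hk, hle⟩ := hY.hinge x y w z w s 1 hs ⟨zero_le_one, le_rfl⟩ hz
    ⟨by rw [one_mul, dist_comm], by simp⟩
  rw [one_mul] at hle
  have hD := hY.mul_dist_nonneg x y
  have hDa := hY.dist_le x y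
  have hlt := hY.bound_lt
  rw [hk]
  set D := r * dist x y
  set b := r * dist x w
  have hsD : 0 ≤ Real.sin D := Real.sin_nonneg_of_nonneg_of_le_pi hD (by linarith)
  have h1 := mul_le_mul_of_nonneg_left hle hsD
  have e : (1 - s) * D = D - s * D := by ring
  rw [e, Real.sin_sub, Real.cos_sub]
  rw [Real.cos_sub] at h1
  have hP := Real.sin_sq_add_cos_sq D
  nlinarith

/-- Moving the far endpoints of two segments from `x` to the fraction `s` contracts distances by
`1 - (1 - s) cos a`. The estimate is obtained for the chordal distance `sin (d / 2)` and carries over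
to `d` by concavity of the sine. -/
theorem IsSmallCATDomain.dist_comb_comb_le (hY : IsSmallCATDomain r a Y) {x y y' z z' : Y} {s : ℝ}
    (hs : s ∈ Set.Icc (0 : ℝ) 1) (hz : IsConvexCombination x y s z)
    (hz' : IsConvexCombination x y' s z') :
    dist z z' ≤ (1 - (1 - s) * Real.cos a) * dist y y' := by
  obtain ⟨k, hk0, hk, hle⟩ := hY.hinge x y y' z z' s s hs hs hz hz'
  have hpi := Real.pi_pos
  have hlt := hY.bound_lt
  have hA := hY.mul_dist_nonneg x y
  have hB := hY.mul_dist_nonneg x y'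
  have hAa := hY.dist_le x y
  have hBa := hY.dist_le x y'
  have hc := hY.mul_dist_nonneg y y'
  have hca := hY.dist_le y y'
  have hc' := hY.mul_dist_nonneg z z'
  have hca' := hY.dist_le z z'
  have hcos0 : 0 ≤ Real.cos a :=
    Real.cos_nonneg_of_neg_pi_div_two_le_of_le (by linarith) (by linarith)
  set ρ := 1 - (1 - s) * Real.cos a with hρ
  have hρ1 : ρ ≤ 1 := by nlinarith [hs.2]
  have hρ0 : 0 ≤ ρ := by nlinarith [hs.1, hs.2, Real.cos_le_one a]
  suffices h : r * dist z z' ≤ r * (ρ * dist y y') from le_of_mul_le_mul_left h hY.scale_pos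
  rw [mul_left_comm]
  set A := r * dist x y
  set B := r * dist x y'
  set c := r * dist y y'
  set c' := r * dist z z'
  have s0 : ∀ v, 0 ≤ v → v ≤ a → 0 ≤ Real.sin v := fun v h0 h1 =>
    Real.sin_nonneg_of_nonneg_of_le_pi h0 (by linarith)
  have t0 : ∀ v, 0 ≤ v → v ≤ a → 0 ≤ Real.sin (s * v) := fun v h0 h1 =>
    s0 _ (mul_nonneg hs.1 h0) ((mul_le_of_le_one_left h0 hs.2).trans h1)
  have h1 : Real.sin (s * A) * Real.sin (s * B) ≤ ρ ^ 2 * (Real.sin A * Real.sin B) := by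
    have := mul_le_mul (sin_mul_le hlt hA hAa hs) (sin_mul_le hlt hB hBa hs) (t0 B hB hBa)
      (mul_nonneg hρ0 (s0 A hA hAa))
    rw [← hρ] at this
    linarith
  have h2 : 1 - Real.cos (s * A - s * B) ≤ ρ ^ 2 * (1 - Real.cos (A - B)) := by
    rw [← mul_sub, ← Real.cos_abs (A - B), ← Real.cos_abs (s * (A - B)), abs_mul,
      abs_of_nonneg hs.1]
    have hd0 := abs_nonneg (A - B)
    have hd : |A - B| ≤ a := abs_le.2 ⟨by linarith, by linarith⟩
    have := sin_mul_le hlt (A := |A - B| / 2) (by positivity) (by linarith) hs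
    rw [← mul_div_assoc] at this
    refine one_sub_cos_mul_le this ?_
    rw [mul_div_assoc]
    exact t0 _ (by positivity) (by linarith)
  have h3 : 1 - Real.cos c' ≤ ρ ^ 2 * (1 - Real.cos c) := by
    rw [hk]
    nlinarith [mul_le_mul_of_nonneg_right h1 hk0]
  have hsc := s0 (c / 2) (by linarith) (by linarith)
  have h4 : Real.sin (c' / 2) ≤ ρ * Real.sin (c / 2) := by
    have e : ∀ z : ℝ, 1 - Real.cos z = 2 * Real.sin (z / 2) ^ 2 := fun z => by
      have := Real.sin_sq_eq_half_sub (z / 2)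
      rw [mul_div_cancel₀ z two_ne_zero] at this
      linarith
    rw [e, e] at h3
    refine le_of_sq_le_sq ?_ (mul_nonneg hρ0 hsc)
    rw [mul_pow]; linarith
  have h5 : ρ * Real.sin (c / 2) ≤ Real.sin (ρ * (c / 2)) :=
    mul_sin_le_sin_mul ⟨hρ0, hρ1⟩ (by linarith) (by linarith)
  have h6 : ρ * c ≤ c := mul_le_of_le_one_left hc hρ1
  have h7 : 0 ≤ ρ * c := mul_nonneg hρ0 hc
  have h8 : c' / 2 ≤ ρ * (c / 2) := by
    by_contra! hlt'
    have := Real.sin_lt_sin_of_lt_of_le_pi_div_two (by linarith) (by linarith) hlt'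
    linarith
  linarith

theorem IsSmallCATDomain.dist_comb_same_le (hY : IsSmallCATDomain r a Y) {x y z z' : Y} {s s' : ℝ}
    (hs : s ∈ Set.Icc (0 : ℝ) 1) (hs' : s' ∈ Set.Icc (0 : ℝ) 1) (hz : IsConvexCombination x y s z)
    (hz' : IsConvexCombination x y s' z') : dist z z' ≤ |s - s'| * dist x y := by
  obtain ⟨k, hk0, hk, hle⟩ := hY.hinge x y y z z' s s' hs hs' hz hz'
  have hpi := Real.pi_pos
  have hlt := hY.bound_lt
  have hA := hY.mul_dist_nonneg x y
  have hAa := hY.dist_le x y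
  have hc' := hY.mul_dist_nonneg z z'
  have hca' := hY.dist_le z z'
  suffices h : r * dist z z' ≤ r * (|s - s'| * dist x y) from le_of_mul_le_mul_left h hY.scale_pos
  rw [mul_left_comm]
  rw [dist_self, mul_zero, sub_self, Real.cos_zero] at hk
  set A := r * dist x y
  have hprod : Real.sin (s * A) * Real.sin (s' * A) * k ≤ 0 := by
    have h0 : Real.sin A * Real.sin A * k = 0 := by linarith
    have m : ∀ t ∈ Set.Icc (0 : ℝ) 1, 0 ≤ Real.sin (t * A) ∧ Real.sin (t * A) ≤ Real.sin A := by
      intro t ht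
      have h1 : t * A ≤ A := mul_le_of_le_one_left hA ht.2
      have h2 : 0 ≤ t * A := mul_nonneg ht.1 hA
      exact ⟨Real.sin_nonneg_of_nonneg_of_le_pi h2 (by linarith),
        Real.sin_le_sin_of_le_of_le_pi_div_two (by linarith) (by linarith) h1⟩
    rw [← h0]
    exact mul_le_mul_of_nonneg_right (mul_le_mul (m s hs).2 (m s' hs').2 (m s' hs').1
      ((m s hs).1.trans (m s hs).2)) hk0
  have hcos : Real.cos (|s - s'| * A) ≤ Real.cos (r * dist z z') := by
    have : |s - s'| * A = |s * A - s' * A| := by rw [← sub_mul, abs_mul, abs_of_nonneg hA]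
    rw [this, Real.cos_abs]
    linarith
  by_contra! hlt'
  have := Real.cos_lt_cos_of_nonneg_of_le_pi (mul_nonneg (abs_nonneg (s - s')) hA)
    (by linarith) hlt'
  linarith

/-- The resolvent is the fixed point of the contraction `y ↦ t u + (1 - t) T y`. -/
theorem IsSmallCATDomain.exists_resolvent [CompleteSpace Y] (hY : IsSmallCATDomain r a Y)
    {T : Y → Y} (hT : LipschitzWith 1 T) (u : Y) {t : ℝ} (ht : 0 < t) (ht' : t ≤ 1) :
    ∃ z, IsConvexCombination u (T z) (1 - t) z := by
  have hs : 1 - t ∈ Set.Icc (0 : ℝ) 1 := ⟨by linarith, by linarith⟩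
  have ha0 : 0 ≤ a := (hY.mul_dist_nonneg u u).trans (hY.dist_le u u)
  have hcos : 0 < Real.cos a := Real.cos_pos_of_mem_Ioo ⟨by linarith [Real.pi_pos], hY.bound_lt⟩
  choose f hf using fun y => hY.exists_comb u (T y) (1 - t) hs
  have hK0 : 0 ≤ 1 - t * Real.cos a := by nlinarith [Real.cos_le_one a]
  have hcontr : ContractingWith (1 - t * Real.cos a).toNNReal f := by
    refine ⟨?_, LipschitzWith.of_dist_le_mul fun y y' => ?_⟩
    · rw [Real.toNNReal_lt_one]
      nlinarith
    · have h1 := hY.dist_comb_comb_le hs (hf y) (hf y')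
      rw [sub_sub_cancel] at h1
      have h2 := hT.dist_le_mul y y'
      rw [NNReal.coe_one, one_mul] at h2
      rw [Real.coe_toNNReal _ hK0]
      exact h1.trans (mul_le_mul_of_nonneg_left h2 hK0)
  have : Nonempty Y := ⟨u⟩
  have hfix : f hcontr.fixedPoint = hcontr.fixedPoint := hcontr.fixedPoint_isFixedPt
  have h := hf hcontr.fixedPoint
  rw [hfix] at h
  exact ⟨_, h⟩

/-- Up to the multiple `d(p, Tp) / t` of the displacement of `p`, the angle at the resolvent `z`
between `u` and any point `p` is at least a right angle, in the form of the spherical Pythagorean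
inequality. -/
theorem IsSmallCATDomain.cos_dist_le_of_resolvent (hY : IsSmallCATDomain r a Y) {T : Y → Y}
    (hT : LipschitzWith 1 T) {u z : Y} {t : ℝ} (ht : 0 < t) (ht' : t ≤ 1)
    (hz : IsConvexCombination u (T z) (1 - t) z) (p : Y) :
    Real.cos (r * dist u p) ≤
      Real.cos (r * dist u z) * Real.cos (r * dist z p) + r * dist p (T p) / t := by
  have hs : 1 - t ∈ Set.Icc (0 : ℝ) 1 := ⟨by linarith, by linarith⟩
  have hpi := Real.pi_pos
  have hlt := hY.bound_lt
  have h0 := hY.cos_dist_comb hs hz p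
  have hD := hY.mul_dist_nonneg u (T z)
  have hDa := hY.dist_le u (T z)
  have hzp := hY.mul_dist_nonneg z p
  have hzpa := hY.dist_le z p
  have hpT := hY.mul_dist_nonneg p (T p)
  have huz : r * dist u z = (1 - t) * (r * dist u (T z)) := by rw [dist_comm, hz.1]; ring
  have htri : r * dist (T z) p ≤ r * dist z p + r * dist p (T p) := by
    have h1 := hT.dist_le_mul z p
    rw [NNReal.coe_one, one_mul] at h1
    have h2 := hY.mul_dist_triangle (T z) (T p) p
    rw [dist_comm (T p) p] at h2
    have := mul_le_mul_of_nonneg_left h1 hY.scale_pos.le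
    linarith
  have hTzp := cos_le_cos_add hpT htri
    (hY.mul_dist_nonneg _ _) (by linarith)
  rw [sub_sub_cancel] at h0
  have hcz : 0 ≤ Real.cos (r * dist z p) :=
    Real.cos_nonneg_of_neg_pi_div_two_le_of_le (by linarith) (by linarith)
  rcases hD.eq_or_lt with hD0 | hD0
  · have : u = z := by
      have h : dist u z = 0 := by
        rw [← hD0, mul_zero] at huz
        exact (mul_eq_zero.1 huz).resolve_left hY.scale_pos.ne'
      exact dist_eq_zero.1 h
    rw [← this, dist_self, mul_zero, Real.cos_zero, one_mul]
    have := div_nonneg hpT ht.le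
    linarith
  rw [huz]
  set D := r * dist u (T z)
  set h := r * dist p (T p)
  have hsD : 0 < Real.sin D := Real.sin_pos_of_pos_of_lt_pi hD0 (by linarith)
  have hle : (1 - t) * D ≤ D := mul_le_of_le_one_left hD hs.2
  have hsD0 : 0 ≤ (1 - t) * D := mul_nonneg hs.1 hD
  have hss : 0 ≤ Real.sin ((1 - t) * D) :=
    Real.sin_nonneg_of_nonneg_of_le_pi hsD0 (by linarith)
  have hss' : Real.sin ((1 - t) * D) ≤ Real.sin D :=
    Real.sin_le_sin_of_le_of_le_pi_div_two (by linarith) (by linarith) hle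
  have hst := mul_sin_le_sin_mul (t := t) ⟨ht.le, ht'⟩ hD (by linarith)
  have hst0 : 0 < Real.sin (t * D) := (mul_pos ht hsD).trans_le hst
  have hadd : Real.sin D ≤ Real.sin (t * D) * Real.cos ((1 - t) * D) + Real.sin ((1 - t) * D) := by
    have e : D = t * D + (1 - t) * D := by ring
    conv_lhs => rw [e, Real.sin_add]
    nlinarith [Real.cos_le_one (t * D)]
  have h1 : Real.sin (t * D) *
      (Real.cos (r * dist u p) - Real.cos ((1 - t) * D) * Real.cos (r * dist z p)) ≤
      Real.sin ((1 - t) * D) * h := by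
    nlinarith [mul_le_mul_of_nonneg_left hTzp hss, mul_le_mul_of_nonneg_right hadd hcz]
  suffices h2 : Real.cos (r * dist u p) - Real.cos ((1 - t) * D) * Real.cos (r * dist z p) ≤
      h / t by linarith
  rw [le_div_iff₀ ht]
  refine le_of_mul_le_mul_left ?_ hst0
  nlinarith [mul_le_mul_of_nonneg_right (hst.trans' (mul_le_mul_of_nonneg_left hss' ht.le)) hpT]

/-- The resolvents `z = tu + (1 - t) Tz` with `t = 1 / (i + 1)`, `i ≥ 1`, recede from `u` as `t`
decreases, and the angle at the nearer one, between `u` and the farther one, is at least a right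
one. -/
theorem IsSmallCATDomain.resolvent_obtuse (hY : IsSmallCATDomain r a Y) {T : Y → Y}
    (hT : LipschitzWith 1 T) {u z z' : Y} {i m : ℝ} (hi : 0 < i) (him : i < m)
    (hz : IsConvexCombination u (T z) (1 - 1 / (i + 1)) z)
    (hz' : IsConvexCombination u (T z') (1 - 1 / (m + 1)) z') :
    r * dist u z ≤ r * dist u z' ∧
      Real.cos (r * dist u z') ≤ Real.cos (r * dist u z) * Real.cos (r * dist z z') := by
  have hm : 0 < m := hi.trans him
  have e : ∀ j : ℝ, 0 < j → 1 - 1 / (j + 1) = j / (j + 1) := fun j hj => by field_simp; ring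
  have mem : ∀ j : ℝ, 0 < j → 1 - 1 / (j + 1) ∈ Set.Icc (0 : ℝ) 1 := fun j hj => by
    rw [e j hj]
    exact ⟨by positivity, by rw [div_le_one (by positivity)]; linarith⟩
  obtain ⟨k, hk0, hk, hle⟩ := hY.hinge u (T z) (T z') z z' _ _ (mem i hi) (mem m hm) hz hz'
  have hpi := Real.pi_pos
  have hlt := hY.bound_lt
  have hα : (1 - 1 / (i + 1)) * (r * dist u (T z)) = r * dist u z := by
    rw [dist_comm u z, hz.1]; ring
  have hβ : (1 - 1 / (m + 1)) * (r * dist u (T z')) = r * dist u z' := by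
    rw [dist_comm u z', hz'.1]; ring
  rw [hα, hβ] at hle
  have hA : r * dist u (T z) = r * dist u z + r * dist u z / i := by
    rw [← hα, e i hi]; field_simp
  have hB : r * dist u (T z') = r * dist u z' + r * dist u z' / m := by
    rw [← hβ, e m hm]; field_simp
  have hmono : Real.cos (r * dist z z') ≤ Real.cos (r * dist (T z) (T z')) := by
    have h1 := hT.dist_le_mul z z'
    rw [NNReal.coe_one, one_mul] at h1
    exact Real.cos_le_cos_of_nonneg_of_le_pi (hY.mul_dist_nonneg _ _)
      ((hY.dist_le z z').trans (by linarith)) (mul_le_mul_of_nonneg_left h1 hY.scale_pos.le)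
  obtain ⟨h1, h2⟩ := obtuse_of_dist_le (hY.mul_dist_nonneg u z) (hY.mul_dist_nonneg u z') hk0 hi
    him hA hB ((hY.dist_le _ _).trans_lt hlt) ((hY.dist_le _ _).trans_lt hlt)
    (by rw [← hk]; linarith)
  refine ⟨h1, h2.trans (mul_le_mul_of_nonneg_left hle ?_)⟩
  have := hY.mul_dist_nonneg u z
  have := hY.dist_le u z
  exact Real.cos_nonneg_of_neg_pi_div_two_le_of_le (by linarith) (by linarith)

/-- One step of the iteration: with `p' = λ u + (1 - λ) q` and a point `z` at which the angle between
`u` and `p'` is at least a right one up to `err`, the quantity `1 - cos d(·, z)` contracts towards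
`err / cos a`. -/
theorem IsSmallCATDomain.one_sub_cos_step (hY : IsSmallCATDomain r a Y) {u q p' z : Y} {l err : ℝ}
    (hl : 0 ≤ l) (hl' : l ≤ 1) (hp' : IsConvexCombination u q (1 - l) p') (herr : 0 ≤ err)
    (h : Real.cos (r * dist u p') ≤ Real.cos (r * dist u z) * Real.cos (r * dist z p') + err) :
    ∃ ρ, 0 ≤ ρ ∧ ρ ≤ 1 - l * Real.cos a ∧ 1 - Real.cos (r * dist z p') ≤
      ρ * (1 - Real.cos (r * dist z q)) + (1 - ρ) * (err / Real.cos a) := by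
  have hs : 1 - l ∈ Set.Icc (0 : ℝ) 1 := ⟨by linarith, by linarith⟩
  have hpi := Real.pi_pos
  have hlt := hY.bound_lt
  have h0 := hY.cos_dist_comb hs hp' z
  have hE := hY.mul_dist_nonneg u q
  have hEa := hY.dist_le u q
  have hup : r * dist u p' = (1 - l) * (r * dist u q) := by rw [dist_comm, hp'.1]; ring
  have hcos : 0 < Real.cos a := Real.cos_pos_of_mem_Ioo ⟨by linarith, hlt⟩
  have hcos1 := Real.cos_le_one a
  have hU : 0 ≤ Real.cos (r * dist u z) := by
    have := hY.mul_dist_nonneg u z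
    have := hY.dist_le u z
    exact Real.cos_nonneg_of_neg_pi_div_two_le_of_le (by linarith) (by linarith)
  have hc'1 := Real.cos_le_one (r * dist z p')
  have hC1 := Real.cos_le_one (r * dist u z)
  have herr' : err ≤ err / Real.cos a := by rw [le_div_iff₀ hcos]; nlinarith
  rw [dist_comm q z, dist_comm p' z, sub_sub_cancel] at h0
  rw [hup] at h
  have hc0 : 0 ≤ Real.cos (r * dist z p') := by
    have := hY.mul_dist_nonneg z p'
    have := hY.dist_le z p'
    exact Real.cos_nonneg_of_neg_pi_div_two_le_of_le (by linarith) (by linarith)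
  rcases hE.eq_or_lt with hE0 | hE0
  · refine ⟨0, le_rfl, by nlinarith, ?_⟩
    rw [← hE0, mul_zero, Real.cos_zero] at h
    nlinarith
  set E := r * dist u q
  have hsE : 0 < Real.sin E := Real.sin_pos_of_pos_of_lt_pi hE0 (by linarith)
  have hss := sin_mul_le hlt hE hEa hs
  rw [sub_sub_cancel] at hss
  have hle : l * E ≤ E := mul_le_of_le_one_left hE hl'
  have hl0 : 0 ≤ l * E := mul_nonneg hl hE
  have hsl : 0 ≤ Real.sin (l * E) := Real.sin_nonneg_of_nonneg_of_le_pi hl0 (by linarith)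
  have hs0 : 0 ≤ Real.sin ((1 - l) * E) :=
    Real.sin_nonneg_of_nonneg_of_le_pi (mul_nonneg hs.1 hE)
      ((mul_le_of_le_one_left hE hs.2).trans (by linarith))
  have hadd : Real.sin E = Real.sin (l * E) * Real.cos ((1 - l) * E) +
      Real.cos (l * E) * Real.sin ((1 - l) * E) := by
    rw [← Real.sin_add]; congr 1; ring
  -- `sin E - sin ((1 - l) E) = 2 sin (l E / 2) cos (E - l E / 2)` and `sin (l E) ≤ 2 sin (l E / 2)`.
  have hdiff : Real.sin (l * E) * Real.cos a ≤ Real.sin E - Real.sin ((1 - l) * E) := by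
    rw [Real.sin_sub_sin]
    have e1 : (E - (1 - l) * E) / 2 = l * E / 2 := by ring
    have e2 : (E + (1 - l) * E) / 2 = E - l * E / 2 := by ring
    have e3 : Real.sin (l * E) = 2 * Real.sin (l * E / 2) * Real.cos (l * E / 2) := by
      rw [← Real.sin_two_mul]; congr 1; ring
    rw [e1, e2, e3]
    have c1 : Real.cos a ≤ Real.cos (E - l * E / 2) :=
      Real.cos_le_cos_of_nonneg_of_le_pi (by linarith) (by linarith) (by linarith)
    have c2 := Real.cos_le_one (l * E / 2)
    have c3 : 0 ≤ Real.sin (l * E / 2) :=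
      Real.sin_nonneg_of_nonneg_of_le_pi (by linarith) (by linarith)
    have c4 : Real.cos (l * E / 2) * Real.cos a ≤ Real.cos (E - l * E / 2) := by nlinarith
    nlinarith
  have hUc : Real.cos ((1 - l) * E) - err ≤ Real.cos (r * dist u z) := by nlinarith
  have hmain : (1 - Real.cos (r * dist z p')) * Real.sin E ≤
      Real.sin ((1 - l) * E) * (1 - Real.cos (r * dist z q)) + Real.sin (l * E) * err := by
    nlinarith [mul_le_mul_of_nonneg_left hUc hsl, Real.cos_le_one (l * E)]
  refine ⟨Real.sin ((1 - l) * E) / Real.sin E, div_nonneg hs0 hsE.le,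
    (div_le_iff₀ hsE).2 hss, ?_⟩
  refine le_of_mul_le_mul_right (hmain.trans ?_) hsE
  have e4 : (Real.sin ((1 - l) * E) / Real.sin E * (1 - Real.cos (r * dist z q)) +
      (1 - Real.sin ((1 - l) * E) / Real.sin E) * (err / Real.cos a)) * Real.sin E =
      Real.sin ((1 - l) * E) * (1 - Real.cos (r * dist z q)) +
        (Real.sin E - Real.sin ((1 - l) * E)) * (err / Real.cos a) := by
    field_simp
  rw [e4]
  have := mul_le_mul_of_nonneg_right hdiff (div_nonneg herr hcos.le)
  rw [mul_assoc, mul_div_cancel₀ _ hcos.ne'] at this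
  linarith

end Domain

/-! ### Recursive inequalities with divergent weights -/

/-- The product of the factors `1 - σ / (k + c)`, `N ≤ k < n`, is at most
`((N + c) / (n + c)) ^ σ`, written here as an exponential. -/
theorem le_of_contracting_recursion {s ρ h : ℕ → ℝ} {σ E K c : ℝ} {N : ℕ} (hσ : 0 ≤ σ)
    (hc : 0 < c) (hK : 0 ≤ K) (hN : s N ≤ E + K) (hh : ∀ n, h n ≤ h (n + 1))
    (hρ : ∀ n, N ≤ n → 0 ≤ ρ n ∧ ρ n ≤ 1 - σ / (n + c))
    (hs : ∀ n, N ≤ n → s (n + 1) ≤ ρ n * s n + (1 - ρ n) * E + (h (n + 1) - h n))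
    (n : ℕ) (hn : N ≤ n) :
    s n ≤ E + Real.exp (-(σ * (Real.log (n + c) - Real.log (N + c)))) * K + (h n - h N) := by
  induction n, hn using Nat.le_induction with
  | base => simpa using hN
  | succ n hn ih =>
    obtain ⟨h0, h1⟩ := hρ n hn
    have hx : 0 < (n : ℝ) + c := by positivity
    have hhn : h N ≤ h n := monotone_nat_of_le_succ hh hn
    have hlog : Real.log ((n + 1 : ℕ) + c) - Real.log (n + c) ≤ 1 / (n + c) := by
      rw [← Real.log_div (by positivity) hx.ne']
      refine (Real.log_le_sub_one_of_pos (by positivity)).trans (le_of_eq ?_)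
      push_cast
      field_simp
      ring
    have hexp : ρ n * Real.exp (-(σ * (Real.log (n + c) - Real.log (N + c)))) ≤
        Real.exp (-(σ * (Real.log ((n + 1 : ℕ) + c) - Real.log (N + c)))) := by
      have h2 : ρ n ≤ Real.exp (-(σ / (n + c))) :=
        h1.trans (by linarith [Real.add_one_le_exp (-(σ / (n + c)))])
      refine (mul_le_mul_of_nonneg_right h2 (Real.exp_pos _).le).trans ?_
      rw [← Real.exp_add, Real.exp_le_exp]
      have h3 := mul_le_mul_of_nonneg_left hlog hσ
      rw [mul_one_div] at h3
      linarith
    have hρ1 : ρ n ≤ 1 := h1.trans (by linarith [div_nonneg hσ hx.le])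
    have h4 := hs n hn
    have h5 := mul_le_mul_of_nonneg_left ih h0
    have h6 := mul_le_mul_of_nonneg_right hexp hK
    have h7 : ρ n * (h n - h N) ≤ h n - h N := mul_le_of_le_one_left (by linarith) hρ1
    linarith

/-- Between `4 ^ (p + 1)` and `4 ^ (S (p + q) + 1)` with `S ≥ 1 / σ`, the logarithm weighted with `σ`
grows by `q` at least. -/
theorem le_log_sub_log {σ c : ℝ} {S N n p q : ℕ} (hσ : 0 ≤ σ) (hS : 1 ≤ σ * S) (hσ1 : σ ≤ 1)
    (hc : 0 < c) (hN : (N : ℝ) + c ≤ 4 ^ (p + 1)) (hn : 4 ^ (S * (p + q) + 1) ≤ n) :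
    (q : ℝ) ≤ σ * (Real.log (n + c) - Real.log (N + c)) := by
  have hlog4 : 1 ≤ Real.log 4 := by
    rw [Real.le_log_iff_exp_le (by norm_num)]
    linarith [Real.exp_one_lt_d9]
  have h1 : Real.log (N + c) ≤ (p + 1) * Real.log 4 := by
    have := Real.log_le_log (by positivity) hN
    rwa [Real.log_pow, Nat.cast_add, Nat.cast_one] at this
  have h2 : (S * (p + q) + 1) * Real.log 4 ≤ Real.log (n + c) := by
    have hn' : (4 : ℝ) ^ (S * (p + q) + 1) ≤ n + c := by
      have : ((4 ^ (S * (p + q) + 1) : ℕ) : ℝ) ≤ n := by exact_mod_cast hn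
      push_cast at this
      linarith
    have := Real.log_le_log (by positivity) hn'
    rw [Real.log_pow] at this
    push_cast at this
    exact this
  have hS1 : (1 : ℝ) ≤ S := by
    have : (0 : ℝ) ≤ S := by positivity
    nlinarith
  have h3 : (S : ℝ) * q ≤ Real.log (n + c) - Real.log (N + c) := by
    have hp : (p : ℝ) ≤ S * p := le_mul_of_one_le_left (by positivity) hS1
    have hq : 0 ≤ (S : ℝ) * q := by positivity
    have h4 : (S : ℝ) * q * Real.log 4 ≤ Real.log (n + c) - Real.log (N + c) := by nlinarith
    nlinarith
  have h5 := mul_le_mul_of_nonneg_left h3 hσ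
  have : (q : ℝ) ≤ σ * S * q := le_mul_of_one_le_left (by positivity) hS
  linarith

/-! ### Asymptotic regularity of the Halpern iteration -/

section Iteration

variable {Y : Type*} [MetricSpace Y] {r a : ℝ}

/-- Consecutive distances satisfy `s_{k+1} ≤ (1 - λ_{k+2} cos a) s_k + (λ_{k+1} - λ_{k+2}) a` with
`λ_k = 1 / (k + 1)`, and the perturbations telescope. -/
theorem IsSmallCATDomain.dist_apply_le_exp (hY : IsSmallCATDomain r a Y) {T : Y → Y}
    (hT : LipschitzWith 1 T) {u : Y} {x : ℕ → Y}
    (hx : ∀ n : ℕ, IsConvexCombination u (T (x n)) (1 - 1 / ((n : ℝ) + 2)) (x (n + 1)))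
    {m n : ℕ} (hmn : m ≤ n) :
    r * dist (x n) (T (x n)) ≤
      a * (Real.exp (-(Real.cos a * (Real.log (n + 3) - Real.log (m + 3)))) + 1 / (m + 2)) := by
  have ha0 : 0 ≤ a := (hY.mul_dist_nonneg u u).trans (hY.dist_le u u)
  have hcos : 0 ≤ Real.cos a :=
    Real.cos_nonneg_of_neg_pi_div_two_le_of_le (by linarith [Real.pi_pos]) hY.bound_lt.le
  have hcos1 := Real.cos_le_one a
  have hmem : ∀ b : ℝ, 1 ≤ b → 1 - 1 / b ∈ Set.Icc (0 : ℝ) 1 := fun b hb => by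
    have h0 : 0 ≤ 1 / b := by positivity
    have h1 : 1 / b ≤ 1 := by rw [div_le_one (by linarith)]; exact hb
    exact ⟨by linarith, by linarith⟩
  have hstep : ∀ k : ℕ, r * dist (x (k + 2)) (x (k + 1)) ≤
      (1 - Real.cos a / (k + 3)) * (r * dist (x (k + 1)) (x k)) +
        (-a / ((k + 1 : ℕ) + 2) - -a / (k + 2)) := by
    intro k
    have hk2 := hmem ((k : ℝ) + 2) (by linarith [(Nat.cast_nonneg k : (0 : ℝ) ≤ k)])
    have hk3 := hmem ((k : ℝ) + 3) (by linarith [(Nat.cast_nonneg k : (0 : ℝ) ≤ k)])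
    have hx' := hx (k + 1)
    have e : ((k + 1 : ℕ) : ℝ) + 2 = k + 3 := by push_cast; ring
    rw [e] at hx' ⊢
    obtain ⟨y, hy⟩ := hY.exists_comb u (T (x k)) _ hk3
    have h1 := hY.dist_comb_comb_le hk3 hx' hy
    have h2 := hY.dist_comb_same_le hk3 hk2 hy (hx k)
    have h3 := hT.dist_le_mul (x (k + 1)) (x k)
    rw [NNReal.coe_one, one_mul] at h3
    rw [sub_sub_cancel, one_div_mul_eq_div] at h1
    have h4 : 0 ≤ 1 - Real.cos a / (k + 3) := by
      have : Real.cos a / (k + 3) ≤ 1 := by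
        rw [div_le_one (by positivity)]
        linarith [(Nat.cast_nonneg k : (0 : ℝ) ≤ k)]
      linarith
    have h5 : |1 - 1 / ((k : ℝ) + 3) - (1 - 1 / (k + 2))| = 1 / (k + 2) - 1 / (k + 3) := by
      have : 1 / ((k : ℝ) + 3) ≤ 1 / (k + 2) := by gcongr; norm_num
      rw [abs_of_nonneg (by linarith)]; ring
    rw [h5] at h2
    have h6 := hY.mul_dist_triangle (x (k + 2)) y (x (k + 1))
    have h7 := mul_le_mul_of_nonneg_left (h1.trans (mul_le_mul_of_nonneg_left h3 h4))
      hY.scale_pos.le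
    have h8 := mul_le_mul_of_nonneg_left h2 hY.scale_pos.le
    have h9 : (1 / ((k : ℝ) + 2) - 1 / (k + 3)) * (r * dist u (T (x k))) ≤
        (1 / ((k : ℝ) + 2) - 1 / (k + 3)) * a :=
      mul_le_mul_of_nonneg_left (hY.dist_le _ _) (h5 ▸ abs_nonneg _)
    have e2 : -a / ((k : ℝ) + 3) - -a / (k + 2) = (1 / ((k : ℝ) + 2) - 1 / (k + 3)) * a := by ring
    rw [e2]
    linarith
  have hrec := le_of_contracting_recursion (s := fun k => r * dist (x (k + 1)) (x k))
    (ρ := fun k => 1 - Real.cos a / (k + 3)) (h := fun k => -a / ((k : ℝ) + 2)) (E := 0) (K := a)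
    (c := 3) (N := m) hcos (by norm_num) ha0 (by simpa using hY.dist_le _ _)
    (fun k => by
      have : a / (((k + 1 : ℕ) : ℝ) + 2) ≤ a / (k + 2) := by gcongr; simp
      simp only [neg_div]
      linarith)
    (fun k _ => ⟨by
      have : Real.cos a / ((k : ℝ) + 3) ≤ 1 := by
        rw [div_le_one (by positivity)]
        linarith [(Nat.cast_nonneg k : (0 : ℝ) ≤ k)]
      linarith, le_rfl⟩)
    (fun k _ => by simpa using hstep k) n hmn
  have h1 := hY.mul_dist_triangle (x n) (x (n + 1)) (T (x n))
  rw [dist_comm (x n) (x (n + 1)), (hx n).2, sub_sub_cancel] at h1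
  have h2 : r * (1 / ((n : ℝ) + 2) * dist u (T (x n))) ≤ 1 / ((n : ℝ) + 2) * a := by
    rw [mul_left_comm]
    exact mul_le_mul_of_nonneg_left (hY.dist_le _ _) (by positivity)
  have e : -a / ((n : ℝ) + 2) - -a / (m + 2) = 1 / ((m : ℝ) + 2) * a - 1 / ((n : ℝ) + 2) * a := by
    ring
  simp only [e] at hrec
  linarith

theorem one_le_cos_mul_secCeil {κ M : ℝ} (h : 0 < Real.cos (M * √κ)) :
    1 ≤ Real.cos (M * √κ) * secCeil κ M := by
  have := Nat.le_ceil (1 / Real.cos (M * √κ))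
  rwa [div_le_iff₀' h] at this

theorem nat_add_le_four_pow (p : ℕ) : p + 4 ≤ 4 ^ (p + 1) := by
  induction p with
  | zero => norm_num
  | succ p ih => rw [pow_succ]; omega

/-- `χ_i` is a rate for `(i + 1) d(x_n, T x_n) → 0`. -/
theorem IsSmallCATDomain.dist_apply_le_of_chi_le {κ M : ℝ} (hY : IsSmallCATDomain r (M * √κ) Y)
    (ha0 : 0 < M * √κ) {T : Y → Y} (hT : LipschitzWith 1 T) {u : Y} {x : ℕ → Y}
    (hx : ∀ n : ℕ, IsConvexCombination u (T (x n)) (1 - 1 / ((n : ℝ) + 2)) (x (n + 1)))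
    {i n : ℕ} {δ : ℝ} (hδ : 0 < δ) (hn : chi κ M i δ ≤ n) :
    (i + 1) * (r * dist (x n) (T (x n))) ≤ δ := by
  have hcos : 0 < Real.cos (M * √κ) :=
    Real.cos_pos_of_mem_Ioo ⟨by linarith [Real.pi_pos], hY.bound_lt⟩
  have hcos1 := Real.cos_le_one (M * √κ)
  set L := boundL κ M i δ with hL
  have hLeq : M * √κ * (L * (i + 1)) = Real.cos (M * √κ) * δ / 4 := by
    have hMκ := ha0.ne'
    have hM : M ≠ 0 := left_ne_zero_of_mul hMκ
    have hκ : √κ ≠ 0 := right_ne_zero_of_mul hMκ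
    rw [hL, boundL]
    field_simp
  have hL0 : 0 < L := by
    rw [hL, boundL, mul_assoc 4]
    positivity
  set P := ⌈1 / L⌉₊ with hP
  set Q := max ⌈Real.log (1 / L)⌉₊ 1 with hQ
  have hS := one_le_cos_mul_secCeil hcos
  have hS1 : 1 ≤ secCeil κ M := by
    have : (1 : ℝ) ≤ secCeil κ M := by
      have : (0 : ℝ) ≤ secCeil κ M := by positivity
      nlinarith
    exact_mod_cast this
  have hn' : 4 ^ (secCeil κ M * (P + Q) + 1) ≤ n := hn
  have hPn : P ≤ n := by
    refine le_trans ?_ hn'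
    refine le_trans (by nlinarith) (Nat.lt_pow_self (by norm_num)).le
  have hq := le_log_sub_log hcos.le hS hcos1 (c := 3) (by norm_num)
    (N := P) (p := P) (by
      have : P + 3 ≤ 4 ^ (P + 1) := (nat_add_le_four_pow P).trans' (by omega)
      exact_mod_cast this) hn'
  have hmain := hY.dist_apply_le_exp hT hx hPn
  have hexp : Real.exp (-(Real.cos (M * √κ) * (Real.log (n + 3) - Real.log (P + 3)))) ≤ L := by
    have h1 : Real.log (1 / L) ≤ Q :=
      (Nat.le_ceil _).trans (by exact_mod_cast le_max_left _ _)
    rw [one_div, Real.log_inv] at h1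
    rw [← Real.le_log_iff_exp_le hL0]
    linarith
  have hP2 : 1 / ((P : ℝ) + 2) ≤ L := by
    have h1 := Nat.le_ceil (1 / L)
    rw [div_le_iff₀ hL0] at h1
    rw [div_le_iff₀ (by positivity)]
    nlinarith
  have hi : (0 : ℝ) < i + 1 := by positivity
  calc (i + 1) * (r * dist (x n) (T (x n)))
      ≤ (i + 1) * (M * √κ * (L + L)) :=
        mul_le_mul_of_nonneg_left (hmain.trans
          (mul_le_mul_of_nonneg_left (add_le_add hexp hP2) ha0.le)) hi.le
    _ = 2 * (M * √κ * (L * (i + 1))) := by ring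
    _ ≤ δ := by rw [hLeq]; nlinarith

/-! ### The iteration and the resolvents -/

/-- The error terms for `z_m` are controlled through the resolvent `z_i` with the smaller index,
at the cost of the distance of `z_i` and `z_m`; the displacement of `z_m`, of size `a / (m + 1)`,
is paid for in every step. -/
theorem IsSmallCATDomain.one_sub_cos_halpern_le (hY : IsSmallCATDomain r a Y) {T : Y → Y}
    (hT : LipschitzWith 1 T) {u : Y} {x : ℕ → Y}
    (hx : ∀ n : ℕ, IsConvexCombination u (T (x n)) (1 - 1 / ((n : ℝ) + 2)) (x (n + 1)))
    {i m N : ℕ} {zi zm : Y} (hzi : IsConvexCombination u (T zi) (1 - 1 / ((i : ℝ) + 1)) zi)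
    (hzm : IsConvexCombination u (T zm) (1 - 1 / ((m : ℝ) + 1)) zm) {e η : ℝ}
    (hz : r * dist zi zm ≤ e) (hη : ∀ n, N ≤ n → (i + 1) * (r * dist (x n) (T (x n))) ≤ η)
    {n : ℕ} (hn : N ≤ n) :
    1 - Real.cos (r * dist zm (x n)) ≤ (2 * e + η) / Real.cos a +
      Real.exp (-(Real.cos a * (Real.log (n + 2) - Real.log (N + 2)))) * (1 - Real.cos a) +
        (n - N) * (a / (m + 1)) := by
  have hlt := hY.bound_lt
  have hpi := Real.pi_pos
  have ha0 : 0 ≤ a := (hY.mul_dist_nonneg u u).trans (hY.dist_le u u)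
  have hcos : 0 < Real.cos a := Real.cos_pos_of_mem_Ioo ⟨by linarith, hlt⟩
  have he0 : 0 ≤ e := (hY.mul_dist_nonneg _ _).trans hz
  have hη0 : 0 ≤ η :=
    (mul_nonneg (by positivity) (hY.mul_dist_nonneg _ _)).trans (hη N le_rfl)
  have herr : 0 ≤ 2 * e + η := by linarith
  have hcosle : ∀ y w : Y, 0 ≤ Real.cos (r * dist y w) := fun y w =>
    Real.cos_nonneg_of_neg_pi_div_two_le_of_le (by linarith [hY.mul_dist_nonneg y w])
      (by linarith [hY.dist_le y w])
  have hlip : ∀ y w w' : Y, ∀ t : ℝ, r * dist w w' ≤ t →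
      Real.cos (r * dist y w) ≤ Real.cos (r * dist y w') + t := fun y w w' t ht =>
    cos_le_cos_add ((hY.mul_dist_nonneg _ _).trans ht)
      ((hY.mul_dist_triangle y w w').trans (by linarith)) (hY.mul_dist_nonneg _ _)
      (by linarith [hY.dist_le y w])
  have hm0 : (0 : ℝ) < 1 / (m + 1) := by positivity
  have hstep : ∀ k, N ≤ k → ∃ ρ, (0 ≤ ρ ∧ ρ ≤ 1 - Real.cos a / (k + 2)) ∧
      1 - Real.cos (r * dist zm (x (k + 1))) ≤ ρ * (1 - Real.cos (r * dist zm (x k))) +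
        (1 - ρ) * ((2 * e + η) / Real.cos a) + a / (m + 1) := by
    intro k hk
    have hA := hY.cos_dist_le_of_resolvent hT (t := 1 / ((i : ℝ) + 1)) (by positivity)
      (by rw [div_le_one (by positivity)]; linarith [(Nat.cast_nonneg i : (0 : ℝ) ≤ i)])
      hzi (x (k + 1))
    have hη' := hη (k + 1) (by omega)
    rw [div_div_eq_mul_div, div_one, mul_comm _ ((i : ℝ) + 1)] at hA
    have h1 := hlip u zi zm e hz
    have h2 := hlip (x (k + 1)) zi zm e hz
    rw [dist_comm _ zi, dist_comm _ zm] at h2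
    have hA' : Real.cos (r * dist u (x (k + 1))) ≤
        Real.cos (r * dist u zm) * Real.cos (r * dist zm (x (k + 1))) + (2 * e + η) := by
      have h3 := mul_le_mul_of_nonneg_left h2 (hcosle u zi)
      have h4 := mul_le_mul_of_nonneg_right h1 (hcosle zm (x (k + 1)))
      nlinarith [Real.cos_le_one (r * dist u zi), Real.cos_le_one (r * dist zm (x (k + 1)))]
    obtain ⟨ρ, hρ0, hρ1, hρ⟩ := hY.one_sub_cos_step (l := 1 / ((k : ℝ) + 2)) (by positivity)
      (by rw [div_le_one (by positivity)]; linarith [(Nat.cast_nonneg k : (0 : ℝ) ≤ k)])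
      (hx k) herr hA'
    rw [one_div_mul_eq_div] at hρ1
    refine ⟨ρ, ⟨hρ0, hρ1⟩, hρ.trans ?_⟩
    have hdisp : r * dist zm (T zm) ≤ a / (m + 1) := by
      rw [hzm.2, sub_sub_cancel, mul_left_comm, one_div_mul_eq_div]
      exact div_le_div_of_nonneg_right (hY.dist_le _ _) (by positivity)
    have hT' := hT.dist_le_mul zm (x k)
    rw [NNReal.coe_one, one_mul] at hT'
    have hd : r * dist zm (T (x k)) ≤ r * dist zm (x k) + a / (m + 1) := by
      have h5 := hY.mul_dist_triangle zm (T zm) (T (x k))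
      have h6 := mul_le_mul_of_nonneg_left hT' hY.scale_pos.le
      linarith
    have ht0 : 0 ≤ a / ((m : ℝ) + 1) := by positivity
    have h7 := cos_le_cos_add ht0 hd (hY.mul_dist_nonneg _ _)
      (by linarith [hY.dist_le zm (x k)])
    have hρle : ρ ≤ 1 := hρ1.trans (by
      have : 0 ≤ Real.cos a / ((k : ℝ) + 2) := by positivity
      linarith)
    nlinarith
  choose! ρ hρ hρs using hstep
  have := le_of_contracting_recursion (s := fun k => 1 - Real.cos (r * dist zm (x k)))
    (ρ := ρ) (h := fun k => (k : ℝ) * (a / (m + 1))) (E := (2 * e + η) / Real.cos a)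
    (K := 1 - Real.cos a) (c := 2) (N := N) hcos.le (by norm_num)
    (by linarith [Real.cos_le_one a])
    (by
      have h1 := Real.cos_le_cos_of_nonneg_of_le_pi (hY.mul_dist_nonneg zm (x N)) (by linarith)
        (hY.dist_le zm (x N))
      have h2 := div_nonneg herr hcos.le
      linarith)
    (fun k => by
      have : 0 ≤ a / ((m : ℝ) + 1) := by positivity
      push_cast
      linarith)
    hρ (fun k hk => by
      have := hρs k hk
      push_cast
      linarith) n hn
  rw [sub_mul]
  exact this

/-- If the distances of two resolvents from `u` are close, then so are the resolvents. -/
theorem IsSmallCATDomain.resolvent_dist_le (hY : IsSmallCATDomain r a Y) (ha0 : 0 < a) {T : Y → Y}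
    (hT : LipschitzWith 1 T) {u z z' : Y} {i m : ℝ} (hi : 0 < i) (him : i < m)
    (hz : IsConvexCombination u (T z) (1 - 1 / (i + 1)) z)
    (hz' : IsConvexCombination u (T z') (1 - 1 / (m + 1)) z') {e : ℝ} (he : 0 ≤ e)
    (h : r * dist u z' - r * dist u z ≤ (1 - Real.cos e) / Real.tan a) : r * dist z z' ≤ e := by
  have hlt := hY.bound_lt
  have hpi := Real.pi_pos
  obtain ⟨hle, hcos⟩ := hY.resolvent_obtuse hT hi him hz hz'
  have hα := hY.mul_dist_nonneg u z
  have hβa := hY.dist_le u z'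
  have htan : 0 < Real.tan a := Real.tan_pos_of_pos_of_lt_pi_div_two ha0 hlt
  rw [le_div_iff₀ htan, Real.tan_eq_sin_div_cos] at h
  have hca : 0 < Real.cos a := Real.cos_pos_of_mem_Ioo ⟨by linarith, hlt⟩
  set α := r * dist u z
  set β := r * dist u z'
  have hcα : Real.cos a ≤ Real.cos α :=
    Real.cos_le_cos_of_nonneg_of_le_pi hα (by linarith) (by linarith)
  -- `cos α - cos β ≤ (β - α) sin β` as `sin` increases on `[α, β]`.
  have hdiff : Real.cos α - Real.cos β ≤ (β - α) * Real.sin a := by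
    rw [Real.cos_sub_cos]
    have e1 : (α - β) / 2 = -((β - α) / 2) := by ring
    rw [e1, Real.sin_neg]
    have h1 : Real.sin ((β - α) / 2) ≤ (β - α) / 2 := Real.sin_le (by linarith)
    have h2 : Real.sin ((α + β) / 2) ≤ Real.sin a :=
      Real.sin_le_sin_of_le_of_le_pi_div_two (by linarith) hlt.le (by linarith)
    have h3 : 0 ≤ Real.sin ((α + β) / 2) :=
      Real.sin_nonneg_of_nonneg_of_le_pi (by linarith) (by linarith)
    have h4 : 0 ≤ Real.sin ((β - α) / 2) :=
      Real.sin_nonneg_of_nonneg_of_le_pi (by linarith) (by linarith)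
    have h5 := mul_le_mul h2 h1 h4 (h3.trans h2)
    linarith
  have h1 : (1 - Real.cos (r * dist z z')) * Real.cos α ≤ (β - α) * Real.sin a := by linarith
  have h2 : (1 - Real.cos (r * dist z z')) * Real.cos a ≤ (1 - Real.cos e) * Real.cos a := by
    have h3 := mul_le_mul_of_nonneg_left hcα
      (by linarith [Real.cos_le_one (r * dist z z')] : 0 ≤ 1 - Real.cos (r * dist z z'))
    rw [← mul_div_assoc, div_le_iff₀ hca] at h
    linarith
  have h4 := le_of_mul_le_mul_right h2 hca
  by_contra! hgt
  have := Real.cos_lt_cos_of_nonneg_of_le_pi he (by linarith [hY.dist_le z z']) hgt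
  linarith

end Iteration

/-- Among `B ≥ a / w` consecutive increments of a sequence in `[0, a]`, one is at most `w`. -/
theorem exists_increment_le {α : ℕ → ℝ} {a w : ℝ} {B : ℕ} (h0 : 0 ≤ α 0) (ha : α B ≤ a)
    (hB : 0 < B) (hBw : a ≤ B * w) : ∃ j < B, α (j + 1) - α j ≤ w := by
  by_contra! h
  have h1 : ∑ _j ∈ Finset.range B, w < ∑ j ∈ Finset.range B, (α (j + 1) - α j) :=
    Finset.sum_lt_sum_of_nonempty (Finset.nonempty_range_iff.2 hB.ne')
      fun j hj => h j (Finset.mem_range.1 hj)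
  rw [Finset.sum_range_sub, Finset.sum_const, Finset.card_range, nsmul_eq_mul] at h1
  linarith

/-! ### Comparison of the functionals in the bound -/

section Bounds

variable {κ M ε : ℝ}

theorem le_fStarTilde (ε : ℝ) (g : ℕ → ℕ) (κ M : ℝ) (i : ℕ) :
    i + ⌈1 / eps0 ε κ M⌉₊ ≤ fStarTilde ε g κ M i := by
  simp only [fStarTilde, fStar]; omega

theorem four_mul_chi_le {i n : ℕ} {δ : ℝ} (ha0 : 0 < M * √κ) (hcos : 0 < Real.cos (M * √κ))
    (hδ : 0 < δ) (hδa : δ ≤ M * √κ) (hin : i < n) : 4 * chi κ M i δ ≤ chi κ M n δ := by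
  have hcos1 := Real.cos_le_one (M * √κ)
  have hinv : ∀ j : ℕ, 1 / boundL κ M j δ =
      4 * (M * √κ) * (j + 1) / (Real.cos (M * √κ) * δ) := fun j => by
    rw [boundL, one_div_div, ← mul_assoc]
  have hpos : 0 < Real.cos (M * √κ) * δ := by positivity
  have hgrow : 1 / boundL κ M i δ + 1 ≤ 1 / boundL κ M n δ := by
    have : (i : ℝ) + 1 ≤ n := by exact_mod_cast hin
    rw [hinv, hinv, div_add_one hpos.ne']
    apply div_le_div_of_nonneg_right _ hpos.le
    nlinarith
  have hi0 : 0 < 1 / boundL κ M i δ := by rw [hinv]; positivity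
  have hceil : ⌈1 / boundL κ M i δ⌉₊ + 1 ≤ ⌈1 / boundL κ M n δ⌉₊ := by
    rw [← Nat.ceil_add_one hi0.le]
    exact Nat.ceil_mono hgrow
  have hlog : ⌈Real.log (1 / boundL κ M i δ)⌉₊ ≤ ⌈Real.log (1 / boundL κ M n δ)⌉₊ :=
    Nat.ceil_mono (Real.log_le_log hi0 (by linarith))
  have hS1 : 1 ≤ secCeil κ M := Nat.one_le_ceil_iff.2 (by positivity)
  unfold chi
  rw [← pow_succ']
  refine Nat.pow_le_pow_right (by norm_num) (Nat.succ_le_succ ?_)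
  set P := ⌈1 / boundL κ M i δ⌉₊
  set Q := max ⌈Real.log (1 / boundL κ M i δ)⌉₊ 1
  calc secCeil κ M * (P + Q) + 1 ≤ secCeil κ M * (P + Q + 1) := by nlinarith
    _ ≤ _ := Nat.mul_le_mul_left _ (by
      have : Q ≤ max ⌈Real.log (1 / boundL κ M n δ)⌉₊ 1 := max_le_max hlog le_rfl
      omega)

theorem maxT_le_maxS_add_two (ha0 : 0 < M * √κ) (ha : M * √κ < Real.pi / 2)
    (hδ : 0 < sinSq ε κ) : maxT κ M (sinSq ε κ) ≤ maxS ε κ M + 2 := by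
  refine max_le (Nat.ceil_le.2 ?_) (by omega)
  have hpi := Real.pi_pos
  have hs : 0 < Real.sin (M * √κ / 2) :=
    Real.sin_pos_of_pos_of_lt_pi (by linarith) (by linarith)
  have hs4 : 0 < Real.sin (M * √κ / 4) :=
    Real.sin_pos_of_pos_of_lt_pi (by linarith) (by linarith)
  have hdouble : Real.sin (M * √κ / 2) ^ 2 ≤ 4 * Real.sin (M * √κ / 4) ^ 2 := by
    have : M * √κ / 2 = 2 * (M * √κ / 4) := by ring
    rw [this, Real.sin_two_mul]
    nlinarith [Real.sin_sq_add_cos_sq (M * √κ / 4), sq_nonneg (Real.sin (M * √κ / 4) ^ 2),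
      sq_nonneg (Real.sin (M * √κ / 4))]
  have h1 : Real.log (3 / sinSq ε κ * Real.sin (M * √κ / 2) ^ 2) ≤
      Real.log 4 + Real.log (3 * Real.sin (M * √κ / 4) ^ 2 / sinSq ε κ) := by
    rw [← Real.log_mul (by norm_num) (by positivity)]
    refine Real.log_le_log (by positivity) ?_
    rw [div_mul_eq_mul_div, ← mul_div_assoc]
    apply div_le_div_of_nonneg_right _ hδ.le
    linarith
  have h2 : Real.log 4 ≤ 2 := by
    have : (4 : ℝ) = 2 ^ 2 := by norm_num
    rw [this, Real.log_pow]
    push_cast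
    linarith [Real.log_two_lt_d9]
  have h3 : Real.log (3 * Real.sin (M * √κ / 4) ^ 2 / sinSq ε κ) ≤ maxS ε κ M :=
    (Nat.le_ceil _).trans (by exact_mod_cast le_max_left _ _)
  push_cast
  linarith

/-- `T` may exceed `S`, by at most `ln 4` before rounding; the growth of `χ*` in its index makes up
for this. -/
theorem Theta_le_boundA {i n : ℕ} (ha0 : 0 < M * √κ) (ha : M * √κ < Real.pi / 2)
    (hδ : 0 < sinSq ε κ) (hδa : sinSq ε κ ≤ M * √κ) (hin : i < n) :
    Theta κ M i (sinSq ε κ) ≤ boundA ε κ M n := by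
  have hcos : 0 < Real.cos (M * √κ) :=
    Real.cos_pos_of_mem_Ioo ⟨by linarith [Real.pi_pos], ha⟩
  have hcos1 := Real.cos_le_one (M * √κ)
  have h1 : 4 * chiStar κ M i (sinSq ε κ / 3) ≤ chiStar κ M n (sinSq ε κ / 3) :=
    four_mul_chi_le ha0 hcos (by positivity) (by nlinarith) hin
  have h2 := one_le_chiStar κ M i (sinSq ε κ / 3)
  have h3 := maxT_le_maxS_add_two ha0 ha hδ
  have hΓ : Gam ε κ M n = chiStar κ M n (sinSq ε κ / 3) := by
    rw [Gam, one_div_mul_eq_div]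
  rw [Theta, boundA, hΓ]
  refine Nat.succ_le_succ (Nat.pow_le_pow_right (by norm_num) (Nat.succ_le_succ ?_))
  exact Nat.mul_le_mul_left _ (by omega)

end Bounds

/-! ### Metastability -/

/-- The iterates `x_n` stay within `ε / 2` of the resolvent `z_m` for
`n ∈ [Θ_i, Θ_i + g(Θ_i)]`, if `z_m` is close to `z_i` and `m` is large with respect to `i`. -/
theorem IsSmallCATDomain.dist_resolvent_halpern_le {Y : Type*} [MetricSpace Y] {κ M ε : ℝ}
    {g : ℕ → ℕ} (hY : IsSmallCATDomain √κ (M * √κ) Y) (ha0 : 0 < M * √κ) (hε : 0 < ε)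
    (hεM : ε ≤ M) {T : Y → Y} (hT : LipschitzWith 1 T) {u : Y} {x : ℕ → Y}
    (hx : ∀ n : ℕ, IsConvexCombination u (T (x n)) (1 - 1 / ((n : ℝ) + 2)) (x (n + 1)))
    {i m : ℕ} {zi zm : Y} (hzi : IsConvexCombination u (T zi) (1 - 1 / ((i : ℝ) + 1)) zi)
    (hzm : IsConvexCombination u (T zm) (1 - 1 / ((m : ℝ) + 1)) zm)
    (hz : √κ * dist zi zm ≤ eps0 ε κ M)
    (hm : M * √κ / DeltaStar κ M i (sinSq ε κ) g ≤ m) {n : ℕ}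
    (hn : n ∈ Set.Icc (Theta κ M i (sinSq ε κ))
      (Theta κ M i (sinSq ε κ) + g (Theta κ M i (sinSq ε κ)))) :
    dist zm (x n) ≤ ε / 2 := by
  have hr := hY.scale_pos
  have hlt := hY.bound_lt
  have hpi := Real.pi_pos
  have hεa : ε * √κ ≤ M * √κ := mul_le_mul_of_nonneg_right hεM hr.le
  have hε0 : 0 < ε * √κ := mul_pos hε hr
  have hsin : 0 < Real.sin (ε * √κ / 4) :=
    Real.sin_pos_of_pos_of_lt_pi (by linarith) (by linarith)
  have hδ : 0 < sinSq ε κ := pow_pos hsin 2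
  have hcos : 0 < Real.cos (M * √κ) := Real.cos_pos_of_mem_Ioo ⟨by linarith, hlt⟩
  have hS := one_le_cos_mul_secCeil hcos
  have hS1 : 1 ≤ secCeil κ M := Nat.one_le_ceil_iff.2 (by positivity)
  set δ := sinSq ε κ with hδdef
  set χ := chiStar κ M i (δ / 3) with hχ
  have hχ1 : 1 ≤ χ := one_le_chiStar _ _ _ _
  set Θ := Theta κ M i δ with hΘ
  have hpow : 4 ^ (secCeil κ M * (χ - 1 + maxT κ M δ) + 1) ≤ Θ := by
    rw [hΘ, Theta, ← hχ]; exact Nat.le_succ _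
  have hT1 : 1 ≤ maxT κ M δ := le_max_right _ _
  have hχΘ : χ ≤ Θ := by
    refine le_trans ?_ (hpow.trans' (Nat.lt_pow_self (by norm_num)).le)
    have : χ - 1 + maxT κ M δ ≤ secCeil κ M * (χ - 1 + maxT κ M δ) :=
      Nat.le_mul_of_pos_left _ hS1
    omega
  have hmain := hY.one_sub_cos_halpern_le hT hx hzi hzm hz (N := χ) (η := δ / 3 / 2 * Real.cos (M * √κ))
    (fun k hk => hY.dist_apply_le_of_chi_le ha0 hT hx (by positivity) hk) (hχΘ.trans hn.1)
  -- the three error terms, each at most `2 δ / 3`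
  have e1 : (2 * eps0 ε κ M + δ / 3 / 2 * Real.cos (M * √κ)) / Real.cos (M * √κ) ≤ 2 * δ / 3 := by
    rw [div_le_iff₀ hcos, eps0, ← hδdef]
    nlinarith [mul_pos hcos hδ]
  have e2 : Real.exp (-(Real.cos (M * √κ) * (Real.log (n + 2) - Real.log (χ + 2)))) *
      (1 - Real.cos (M * √κ)) ≤ 2 * δ / 3 := by
    have hq := le_log_sub_log hcos.le hS (Real.cos_le_one _) (c := 2) (by norm_num)
      (N := χ) (p := χ - 1) (q := maxT κ M δ) (by
        have := nat_add_le_four_pow (χ - 1)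
        have h2 : χ + 2 ≤ 4 ^ (χ - 1 + 1) := by omega
        exact_mod_cast h2) (hpow.trans hn.1)
    have hs : 0 < Real.sin (M * √κ / 2) :=
      Real.sin_pos_of_pos_of_lt_pi (by linarith) (by linarith)
    have h1 : Real.log (3 / δ * Real.sin (M * √κ / 2) ^ 2) ≤ maxT κ M δ :=
      (Nat.le_ceil _).trans (by exact_mod_cast le_max_left _ _)
    have h2 : Real.exp (-(Real.cos (M * √κ) * (Real.log (n + 2) - Real.log (χ + 2)))) ≤
        (3 / δ * Real.sin (M * √κ / 2) ^ 2)⁻¹ := by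
      rw [← Real.le_log_iff_exp_le (by positivity), Real.log_inv]
      linarith
    have h3 : 1 - Real.cos (M * √κ) = 2 * Real.sin (M * √κ / 2) ^ 2 := by
      have := Real.sin_sq_eq_half_sub (M * √κ / 2)
      rw [mul_div_cancel₀ _ two_ne_zero] at this
      linarith
    rw [h3]
    refine (mul_le_mul_of_nonneg_right h2 (by positivity)).trans (le_of_eq ?_)
    have hs' := hs.ne'
    field_simp
  have e3 : ((n : ℝ) - χ) * (M * √κ / (m + 1)) ≤ 2 * δ / 3 := by
    rw [DeltaStar, ← hΘ, ← hχ, div_div_eq_mul_div, div_le_iff₀ hδ] at hm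
    have h1 : (n : ℝ) ≤ Θ + g Θ := by exact_mod_cast hn.2
    rw [← mul_div_assoc, div_le_iff₀ (by positivity)]
    have h2 : ((n : ℝ) - χ) * (M * √κ) ≤ (Θ + g Θ - χ) * (M * √κ) := by gcongr
    nlinarith
  have hq : 1 - Real.cos (√κ * dist zm (x n)) ≤ 2 * δ := by linarith
  have hd := hY.mul_dist_nonneg zm (x n)
  have hda := hY.dist_le zm (x n)
  have h3 : 1 - Real.cos (√κ * dist zm (x n)) = 2 * Real.sin (√κ * dist zm (x n) / 2) ^ 2 := by
    have := Real.sin_sq_eq_half_sub (√κ * dist zm (x n) / 2)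
    rw [mul_div_cancel₀ _ two_ne_zero] at this
    linarith
  rw [h3, hδdef, sinSq] at hq
  have h4 : Real.sin (√κ * dist zm (x n) / 2) ≤ Real.sin (ε * √κ / 4) :=
    le_of_sq_le_sq (by linarith) hsin.le
  have h5 : √κ * dist zm (x n) / 2 ≤ ε * √κ / 4 := by
    by_contra! hgt
    exact absurd h4 (not_le.2
      (Real.sin_lt_sin_of_lt_of_le_pi_div_two (by linarith) (by linarith) hgt))
  refine le_of_mul_le_mul_left (a := √κ) ?_ hr
  linarith

/-- With `F(i) = i + f*(i)`, the index `i` is `F^j(0) + ⌈1/ε₀⌉` and `m = F^{j+1}(0)`, where `j < B` is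
such that the resolvents with these indices have almost the same distance from `u`. -/
theorem IsSmallCATDomain.halpern_metastable {Y : Type*} [MetricSpace Y] [CompleteSpace Y]
    {κ M ε : ℝ} (g : ℕ → ℕ) (hY : IsSmallCATDomain √κ (M * √κ) Y) (hε : 0 < ε) (hεM : ε ≤ M)
    {T : Y → Y} (hT : LipschitzWith 1 T) {u : Y} {x : ℕ → Y}
    (hx : ∀ n : ℕ, IsConvexCombination u (T (x n)) (1 - 1 / ((n : ℝ) + 2)) (x (n + 1))) :
    ∃ N : ℕ, N ≤ SigmaRate ε g κ M ∧
      ∀ m ∈ Set.Icc N (N + g N), ∀ n ∈ Set.Icc N (N + g N), dist (x n) (x m) ≤ ε := by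
  have hr := hY.scale_pos
  have hlt := hY.bound_lt
  have hpi := Real.pi_pos
  have ha0 : 0 < M * √κ := mul_pos (hε.trans_le hεM) hr
  have hεa : ε * √κ ≤ M * √κ := mul_le_mul_of_nonneg_right hεM hr.le
  have hε0 : 0 < ε * √κ := mul_pos hε hr
  have hsin : 0 < Real.sin (ε * √κ / 4) :=
    Real.sin_pos_of_pos_of_lt_pi (by linarith) (by linarith)
  have hδ : 0 < sinSq ε κ := pow_pos hsin 2
  have hδ1 : sinSq ε κ ≤ 1 := Real.sin_sq_le_one _
  have hδa : sinSq ε κ ≤ M * √κ := by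
    have h1 : Real.sin (ε * √κ / 4) ≤ ε * √κ / 4 := Real.sin_le (by linarith)
    have h2 : sinSq ε κ ≤ Real.sin (ε * √κ / 4) := by
      rw [sinSq, sq]
      exact mul_le_of_le_one_left hsin.le (Real.sin_le_one _)
    linarith
  have hcos : 0 < Real.cos (M * √κ) := Real.cos_pos_of_mem_Ioo ⟨by linarith, hlt⟩
  have hcos1 := Real.cos_le_one (M * √κ)
  set e := eps0 ε κ M with he
  have he0 : 0 < e := by rw [he, eps0]; positivity
  have he1 : e ≤ 1 := by rw [he, eps0]; nlinarith
  have hepi : e ≤ Real.pi := by linarith [Real.pi_gt_three]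
  have hce : Real.cos e < 1 := by
    rw [← Real.cos_zero]
    exact Real.cos_lt_cos_of_nonneg_of_le_pi le_rfl hepi he0
  have htan : 0 < Real.tan (M * √κ) := Real.tan_pos_of_pos_of_lt_pi_div_two ha0 hlt
  have hres : ∀ i : ℕ, ∃ z, IsConvexCombination u (T z) (1 - 1 / ((i : ℝ) + 1)) z := fun i =>
    hY.exists_resolvent hT u (by positivity)
      (by rw [div_le_one (by positivity)]; linarith [(Nat.cast_nonneg i : (0 : ℝ) ≤ i)])
  choose z hz using hres
  have hmono : ∀ i m : ℕ, 0 < i → i ≤ m → √κ * dist u (z i) ≤ √κ * dist u (z m) := by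
    intro i m hi him
    rcases him.eq_or_lt with rfl | him
    · exact le_rfl
    · exact (hY.resolvent_obtuse hT (by exact_mod_cast hi) (by exact_mod_cast him)
        (hz i) (hz m)).1
  set c := ⌈1 / e⌉₊ with hc
  have hc0 : 0 < c := Nat.ceil_pos.2 (by positivity)
  set F := fStarTilde ε g κ M with hF
  have hB0 : 0 < boundB ε κ M := by
    refine Nat.ceil_pos.2 (div_pos (mul_pos ha0 htan) ?_)
    rw [← he]; linarith
  obtain ⟨j, hj, hjle⟩ := exists_increment_le (α := fun j => √κ * dist u (z (F^[j] 0 + c)))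
    (a := M * √κ) (w := (1 - Real.cos e) / Real.tan (M * √κ)) (hY.mul_dist_nonneg _ _)
    (hY.dist_le _ _) hB0 (by
      have h1 := Nat.le_ceil (M * √κ * Real.tan (M * √κ) / (1 - Real.cos (eps0 ε κ M)))
      rw [← he, div_le_iff₀ (by linarith)] at h1
      rw [← mul_div_assoc, le_div_iff₀ htan]
      exact h1)
  set i := F^[j] 0 + c with hi
  set m := F^[j + 1] 0 with hm
  have hi0 : 0 < i := by omega
  have hmF : m = F (F^[j] 0) := by rw [hm, Function.iterate_succ_apply']
  have hmax : m = max ⌈M * √κ / DeltaStar κ M i (sinSq ε κ) g⌉₊ i := by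
    rw [hmF]
    change F^[j] 0 + (funF ε g κ M (F^[j] 0 + c) + c) = _
    rw [← hi, funF]
    omega
  have him : i ≤ m := hmax ▸ le_max_right _ _
  have hzz : √κ * dist (z i) (z m) ≤ e := by
    rcases him.eq_or_lt with him' | him'
    · rw [← him', dist_self, mul_zero]; exact he0.le
    · refine hY.resolvent_dist_le ha0 hT (by exact_mod_cast hi0) (by exact_mod_cast him')
        (hz i) (hz m) he0.le ?_
      have := hmono m (m + c) (by omega) (by omega)
      linarith
  have hmΔ : M * √κ / DeltaStar κ M i (sinSq ε κ) g ≤ m :=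
    (Nat.le_ceil _).trans (by rw [hmax]; exact_mod_cast le_max_left _ _)
  have hclose := fun n => hY.dist_resolvent_halpern_le (n := n) ha0 hε hεM hT hx (hz i) (hz m)
    hzz hmΔ
  refine ⟨Theta κ M i (sinSq ε κ), ?_, fun p hp n hn => ?_⟩
  · have hiter : F^[j + 1] 0 ≤ F^[boundB ε κ M] 0 := by
      refine monotone_nat_of_le_succ (f := fun k => F^[k] 0) (fun k => ?_) hj
      simp only [Function.iterate_succ_apply']
      exact (le_fStarTilde ε g κ M _).trans' (by omega)
    refine Theta_le_boundA ha0 hlt hδ hδa ?_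
    rw [← he, ← hc, ← hF]
    omega
  · have h1 := hclose n hn
    have h2 := hclose p hp
    have h3 := dist_triangle_left (x n) (x p) (z m)
    linarith

end HalpernCAT

theorem mainTheorem4 {X : Type*} [MetricSpace X] [CompleteSpace X] (κ : ℝ) (hκ : 0 < κ)
    (hX : HalpernCAT.IsCATSpace κ X) (C : Set X) (hCb : Bornology.IsBounded C) (hCc : IsClosed C)
    (hCconv : HalpernCAT.IsGeodesicallyConvex C) (M : ℝ) (hCM : Metric.diam C ≤ M)
    (hM : M < HalpernCAT.modelDiam κ / 2) (T : C → C) (hT : LipschitzWith 1 T)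
    (lam : ℕ → ℝ) (hlam : ∀ n : ℕ, 1 ≤ n → lam n = 1 / ((n : ℝ) + 1)) (u : C) (x : ℕ → C)
    (hx : HalpernCAT.IsHalpernIteration T lam u x) (ε : ℝ) (hε : ε ∈ Set.Ioo (0 : ℝ) 2)
    (g : ℕ → ℕ) :
    ∃ N : ℕ, N ≤ HalpernCAT.SigmaRate ε g κ M ∧
      ∀ m ∈ Set.Icc N (N + g N), ∀ n ∈ Set.Icc N (N + g N), dist (x n) (x m) ≤ ε := by
  rcases le_total M ε with hMε | hεM
  · exact ⟨0, Nat.zero_le _, fun m _ n _ =>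
      (Metric.dist_le_diam_of_mem hCb (x n).2 (x m).2).trans (hCM.trans hMε)⟩
  have : CompleteSpace C := hCc.completeSpace_coe
  refine (HalpernCAT.isSmallCATDomain_of_convex hκ hX hCb hCconv hCM hM).halpern_metastable
    g hε.1 hεM hT (u := u) fun n => ?_
  have h := hx.succ n
  rw [hlam (n + 1) (by omega)] at h
  have e : ((n + 1 : ℕ) : ℝ) + 1 = n + 2 := by push_cast; ring
  rwa [e] at h
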